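/- For a finite simple graph $G$ and $k\in\mathbb N$, a b-coloring of $G$ with $k$ colors is a proper coloring $c:V(G)\to\{1,\dots,k\}$ such that for every color $i$ there is a vertex $x_i$ with $c(x_i)=i$ that has, for every color $j\ne i$, a neighbor of color $j$. Let $\Delta=\Delta(G)$ be the maximum degree of $G$ and let $\ell=\ell_k(G)$ be the number of vertices of $G$ of degree at least $k$. Consider the problem b-Coloring: given $(G,k)$, decide whether $G$ has a b-coloring with $k$ colors, parameterized by $\Delta+\ell$. A kernelization algorithm for this problem is a polynomial-time algorithm that on input $(G,k)$ either correctly decides whether $G$ has a b-coloring with $k$ colors, or outputs an instance $(G',k')$ such that $G'$ has a b-coloring with $k'$ colors if and only if $G$ has a b-coloring with $k$ colors, and such that the encoding length of $(G',k')$ plus its parameter $\Delta(G')+\ell_{k'}(G')$ is at most $f(\Delta+\ell)$ for a fixed computable function $f$. Statement. There are a kernelization algorithm for b-Coloring parameterized by $\Delta+\ell$ and an absolute constant $C$ such that every instance $(G',k')$ that it outputs on an input $(G,k)$ satisfies $$|V(G')|\le C\cdot \ell\cdot\Delta\cdot\min\{\ell,\Delta\}^{\ell+1}\quad\text{if } k<\ell,\qquad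 |V(G')|\le C\cdot k^4\cdot\Delta\quad\text{if } \ell\le k .$$ -/

import Mathlib

/-! ### b-colorings and degree parameters of a finite simple graph -/

/-- A proper coloring `c` of `G` with color set `Fin k` is a b-coloring if every color `i` has a
b-vertex: a vertex of color `i` with a neighbor of each other color. -/
def IsBColoring {V : Type*} (G : SimpleGraph V) {k : ℕ} (c : G.Coloring (Fin k)) : Prop :=
  ∀ i : Fin k, ∃ x : V, c x = i ∧ ∀ j : Fin k, j ≠ i → ∃ y : V, G.Adj x y ∧ c y = j

/-- `G` has a b-coloring with `k` colors. -/
def HasBColoring {V : Type*} (G : SimpleGraph V) (k : ℕ) : Prop :=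
  ∃ c : G.Coloring (Fin k), IsBColoring G c

open Classical in
/-- `Δ(G)`, the maximum degree. -/
noncomputable def maxDeg {V : Type*} [Fintype V] (G : SimpleGraph V) : ℕ := G.maxDegree

open Classical in
/-- `ℓ_k(G)`, the number of vertices of degree at least `k`. -/
noncomputable def numHighDeg {V : Type*} [Fintype V] (G : SimpleGraph V) (k : ℕ) : ℕ :=
  (Finset.univ.filter fun v : V => k ≤ G.degree v).card

/-! ### A random access machine with a step count

A machine has integer registers, finitely many of which occur in a program, and arrays that are
addressed indirectly. The arithmetic operations are addition and truncated subtraction, at unit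
cost. (There is no unit-cost multiplication, so in `t` steps the bit lengths of numbers grow by at
most `O(t)`: polynomial time on this machine is the usual polynomial time.) -/

namespace Ram

structure State where
  /-- registers -/
  reg : ℕ → ℕ
  /-- `arr a i` is the cell number `i` of the array number `a` -/
  arr : ℕ → ℕ → ℕ
  /-- what has been written to the output tape so far -/
  out : List ℕ

inductive Expr where
  | const (c : ℕ)
  | reg (r : ℕ)
  | get (a : ℕ) (i : Expr)
  | add (e₁ e₂ : Expr)
  | sub (e₁ e₂ : Expr)

def Expr.eval (s : State) : Expr → ℕ
  | .const c => c
  | .reg r => s.reg r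
  | .get a i => s.arr a (i.eval s)
  | .add e₁ e₂ => e₁.eval s + e₂.eval s
  | .sub e₁ e₂ => e₁.eval s - e₂.eval s

/-- The number of steps that the evaluation of an expression takes. -/
def Expr.cost : Expr → ℕ
  | .const _ => 1
  | .reg _ => 1
  | .get _ i => i.cost + 1
  | .add e₁ e₂ => e₁.cost + e₂.cost + 1
  | .sub e₁ e₂ => e₁.cost + e₂.cost + 1

inductive Prog where
  | skip
  /-- assign the value of `e` to register `r` -/
  | set (r : ℕ) (e : Expr)
  /-- assign the value of `e` to cell `i` of array `a` -/
  | put (a : ℕ) (i e : Expr)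
  /-- append the value of `e` to the output tape -/
  | emit (e : Expr)
  | seq (p q : Prog)
  /-- run `p` if the value of `e` is nonzero, otherwise `q` -/
  | ite (e : Expr) (p q : Prog)
  /-- run `p` as long as the value of `e` is nonzero -/
  | loop (e : Expr) (p : Prog)

/-- `Exec p s t s'`: started in state `s`, the program `p` halts after `t` steps in state `s'`. -/
inductive Exec : Prog → State → ℕ → State → Prop
  | skip (s : State) : Exec .skip s 1 s
  | set (s : State) (r : ℕ) (e : Expr) :
      Exec (.set r e) s (e.cost + 1) { s with reg := Function.update s.reg r (e.eval s) }
  | put (s : State) (a : ℕ) (i e : Expr) :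
      Exec (.put a i e) s (i.cost + e.cost + 1)
        { s with
          arr := Function.update s.arr a (Function.update (s.arr a) (i.eval s) (e.eval s)) }
  | emit (s : State) (e : Expr) :
      Exec (.emit e) s (e.cost + 1) { s with out := s.out ++ [e.eval s] }
  | seq {p q : Prog} {s s' s'' : State} {t t' : ℕ} :
      Exec p s t s' → Exec q s' t' s'' → Exec (.seq p q) s (t + t') s''
  | iteTrue {e : Expr} {p q : Prog} {s s' : State} {t : ℕ} :
      e.eval s ≠ 0 → Exec p s t s' → Exec (.ite e p q) s (e.cost + 1 + t) s'
  | iteFalse {e : Expr} {p q : Prog} {s s' : State} {t : ℕ} :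
      e.eval s = 0 → Exec q s t s' → Exec (.ite e p q) s (e.cost + 1 + t) s'
  | loopDone {e : Expr} {p : Prog} {s : State} :
      e.eval s = 0 → Exec (.loop e p) s (e.cost + 1) s
  | loopStep {e : Expr} {p : Prog} {s s' s'' : State} {t t' : ℕ} :
      e.eval s ≠ 0 → Exec p s t s' → Exec (.loop e p) s' t' s'' →
        Exec (.loop e p) s (e.cost + 1 + t + t') s''

/-- The initial state on input `w`: the word is in array 0, its length in register 0, everything
else is zero and the output tape is empty. -/
def init (w : List ℕ) : State where
  reg := fun r => if r = 0 then w.length else 0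
  arr := fun a i => if a = 0 then w.getD i 0 else 0
  out := []

end Ram

/-- The length of a finite sequence of numbers written in binary, with separators. -/
def bitLength (w : List ℕ) : ℕ := (w.map fun a => Nat.size a + 1).sum

/-- `F` is computed by one program, in time polynomial in the bit length of the encoded input. -/
def PolyTimeComputable {α β : Type*} (encα : α → List ℕ) (encβ : β → List ℕ) (F : α → β) : Prop :=
  ∃ (A : Ram.Prog) (p : Polynomial ℕ), ∀ a : α, ∃ (t : ℕ) (s : Ram.State),
    Ram.Exec A (Ram.init (encα a)) t s ∧ s.out = encβ (F a) ∧ t ≤ p.eval (bitLength (encα a))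

/-! ### Parameterized problems and kernels -/

/-- A parameterized decision problem with instances in `ι`. -/
structure ParamProblem (ι : Type*) where
  encode : ι → List ℕ
  param : ι → ℕ
  yes : ι → Prop

/-- A kernelization algorithm either decides its input or returns another instance. -/
inductive KernelOutput (ι : Type*) where
  | decided (b : Bool)
  | reduced (y : ι)

def KernelOutput.encode {ι : Type*} (enc : ι → List ℕ) : KernelOutput ι → List ℕ
  | .decided false => [0]
  | .decided true => [1]
  | .reduced y => 2 :: enc y

/-- `K` is a kernelization algorithm for `P`: it runs in polynomial time, its decisions are
correct, and an instance that it returns is equivalent to the input, with size plus parameter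
bounded by a computable function of the parameter of the input. -/
def IsKernelization {ι : Type*} (P : ParamProblem ι) (K : ι → KernelOutput ι) : Prop :=
  PolyTimeComputable P.encode (KernelOutput.encode P.encode) K ∧
  (∀ x b, K x = .decided b → (b = true ↔ P.yes x)) ∧
  (∀ x y, K x = .reduced y → (P.yes x ↔ P.yes y)) ∧
  ∃ f : ℕ → ℕ, Computable f ∧ ∀ x y, K x = .reduced y →
    bitLength (P.encode y) + P.param y ≤ f (P.param x)

/-! ### The problem b-Coloring parameterized by `Δ(G) + ℓ_k(G)` -/

/-- An instance `(G, k)`; the vertex set of `G` is `{0, …, n - 1}`. -/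
structure BInstance where
  n : ℕ
  G : SimpleGraph (Fin n)
  k : ℕ

open Classical in
/-- The encoding of an instance: `n`, `k`, and the adjacency matrix row by row. -/
noncomputable def BInstance.encode (I : BInstance) : List ℕ :=
  I.n :: I.k :: (List.finRange I.n).flatMap fun u =>
    (List.finRange I.n).map fun v => if I.G.Adj u v then 1 else 0

noncomputable def BInstance.Δ (I : BInstance) : ℕ := maxDeg I.G

noncomputable def BInstance.ell (I : BInstance) : ℕ := numHighDeg I.G I.k

noncomputable def bColoringProblem : ParamProblem BInstance where
  encode := BInstance.encode
  param := fun I => I.Δ + I.ell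
  yes := fun I => HasBColoring I.G I.k

/-! ### Extending and restricting colorings -/

section Coloring

open Classical Finset

variable {V : Type*} [Fintype V] {G : SimpleGraph V} {k : ℕ}

/-- The closed neighborhood of a vertex. -/
noncomputable def closedNbhd (G : SimpleGraph V) (v : V) : Finset V :=
  insert v (G.neighborFinset v)

theorem mem_closedNbhd {u v : V} : u ∈ closedNbhd G v ↔ u = v ∨ G.Adj v u := by
  simp [closedNbhd]

theorem mem_closedNbhd_comm {u v : V} : u ∈ closedNbhd G v ↔ v ∈ closedNbhd G u := by
  simp only [mem_closedNbhd, G.adj_comm, eq_comm]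

theorem self_mem_closedNbhd (v : V) : v ∈ closedNbhd G v := by simp [closedNbhd]

theorem card_closedNbhd (v : V) : (closedNbhd G v).card = G.degree v + 1 := by
  simp [closedNbhd]

/-- A partial proper coloring extends greedily when the remaining vertices have small degree. -/
theorem exists_coloring_extending (S : Finset V) (c₀ : V → Fin k)
    (hproper : ∀ u ∈ S, ∀ v ∈ S, G.Adj u v → c₀ u ≠ c₀ v)
    (hdeg : ∀ v ∉ S, G.degree v < k) :
    ∃ c : G.Coloring (Fin k), ∀ v ∈ S, c v = c₀ v := by
  have key : ∀ R : Finset V, Disjoint R S → ∃ c : V → Fin k, (∀ v ∈ S, c v = c₀ v) ∧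
      ∀ u ∈ S ∪ R, ∀ v ∈ S ∪ R, G.Adj u v → c u ≠ c v := by
    intro R
    induction R using Finset.induction_on with
    | empty => exact fun _ => ⟨c₀, fun _ _ => rfl, by simpa using hproper⟩
    | insert w R hw ih =>
      intro hd
      rw [Finset.disjoint_insert_left] at hd
      obtain ⟨c, hc, hp⟩ := ih hd.2
      obtain ⟨i, hi⟩ : ∃ i : Fin k, i ∉ (G.neighborFinset w).image c := by
        by_contra! h
        have h1 : (univ : Finset (Fin k)) ⊆ (G.neighborFinset w).image c := fun i _ => h i
        have h2 := (card_le_card h1).trans card_image_le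
        have h3 := hdeg w hd.1
        simp at h2
        omega
      simp only [mem_image, SimpleGraph.mem_neighborFinset, not_exists, not_and] at hi
      refine ⟨Function.update c w i, fun v hv => ?_, ?_⟩
      · rw [Function.update_of_ne (by rintro rfl; exact hd.1 hv), hc v hv]
      · intro u hu v hv huv
        rw [union_insert, mem_insert] at hu hv
        by_cases h1 : u = w
        · subst h1
          rw [Function.update_self, Function.update_of_ne huv.ne']
          exact fun h => hi v huv h.symm
        · by_cases h2 : v = w
          · subst h2
            rw [Function.update_self, Function.update_of_ne huv.ne]
            exact hi u huv.symm
          · rw [Function.update_of_ne h1, Function.update_of_ne h2]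
            exact hp u (hu.resolve_left h1) v (hv.resolve_left h2) huv
  obtain ⟨c, hc, hp⟩ := key (univ \ S) sdiff_disjoint
  refine ⟨SimpleGraph.Coloring.mk c fun {u v} huv => hp u ?_ v ?_ huv, hc⟩ <;> simp

/-- If the subgraph induced by a set that contains all vertices of degree at least `k` has a
b-coloring with `k` colors, then so does the whole graph. -/
theorem HasBColoring.of_comap {V' : Type*} (e : V' ↪ V)
    (hdeg : ∀ v ∉ Set.range e, G.degree v < k) (h : HasBColoring (G.comap e) k) :
    HasBColoring G k := by
  obtain ⟨c, hc⟩ := h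
  by_cases hk : k = 0
  · subst hk
    have : IsEmpty V := ⟨fun v => by
      by_cases hv : v ∈ Set.range e
      · obtain ⟨w, -⟩ := hv
        exact (c w).elim0
      · exact absurd (hdeg v hv) (by omega)⟩
    exact ⟨SimpleGraph.Coloring.mk (fun v => (this.false v).elim) (fun {v} => (this.false v).elim),
      fun i => i.elim0⟩
  obtain ⟨x₀, -⟩ := hc ⟨0, by omega⟩
  let c₀ : V → Fin k := Function.extend e c fun _ => ⟨0, by omega⟩
  have hc₀ : ∀ w, c₀ (e w) = c w := fun w => e.injective.extend_apply _ _ _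
  obtain ⟨c', hc'⟩ := exists_coloring_extending (G := G) (univ.filter (· ∈ Set.range e)) c₀
    (by
      simp only [mem_filter, mem_univ, true_and]
      rintro _ ⟨u, rfl⟩ _ ⟨v, rfl⟩ huv
      rw [hc₀, hc₀]
      exact c.valid huv)
    (fun v hv => hdeg v (by simpa using hv))
  have hval : ∀ w, c' (e w) = c w := fun w => by rw [hc' _ (by simp), hc₀]
  refine ⟨c', fun i => ?_⟩
  obtain ⟨x, hx, hb⟩ := hc i
  refine ⟨e x, by rw [hval, hx], fun j hj => ?_⟩
  obtain ⟨y, hxy, hy⟩ := hb j hj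
  exact ⟨e y, hxy, by rw [hval, hy]⟩

/-- A coloring restricts to a b-coloring of every induced subgraph that contains the closed
neighborhood of a b-vertex of each color. -/
theorem HasBColoring.comap {V' : Type*} (e : V' ↪ V) (c : G.Coloring (Fin k))
    (h : ∀ i : Fin k, ∃ x : V, (∀ y ∈ closedNbhd G x, y ∈ Set.range e) ∧ c x = i ∧
      ∀ j : Fin k, j ≠ i → ∃ y : V, G.Adj x y ∧ c y = j) :
    HasBColoring (G.comap e) k := by
  refine ⟨SimpleGraph.Coloring.mk (fun v => c (e v)) fun {u v} huv => c.valid huv, fun i => ?_⟩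
  obtain ⟨x, hx, hi, hb⟩ := h i
  obtain ⟨x', rfl⟩ := hx x (self_mem_closedNbhd x)
  refine ⟨x', hi, fun j hj => ?_⟩
  obtain ⟨y, hxy, hy⟩ := hb j hj
  obtain ⟨y', rfl⟩ := hx y (mem_closedNbhd.2 (Or.inr hxy))
  exact ⟨y', hxy, hy⟩

/-- A b-vertex has degree at least `k - 1`. -/
theorem le_degree_add_one_of_bVertex (c : G.Coloring (Fin k)) {x : V}
    (h : ∀ j : Fin k, j ≠ c x → ∃ y : V, G.Adj x y ∧ c y = j) : k ≤ G.degree x + 1 := by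
  have : (univ : Finset (Fin k)) ⊆ (closedNbhd G x).image c := by
    intro j _
    rw [mem_image]
    by_cases hj : j = c x
    · exact ⟨x, self_mem_closedNbhd x, hj.symm⟩
    · obtain ⟨y, hy, hyj⟩ := h j hj
      exact ⟨y, mem_closedNbhd.2 (Or.inr hy), hyj⟩
  simpa [card_closedNbhd] using (card_le_card this).trans card_image_le

/-! ### Scattered sets of vertices of degree `k - 1` -/

/-- Greedy choice of `j` elements, none of them in the small conflict set of an earlier one. -/
theorem exists_conflict_free {V : Type*} (F : Finset V) (conf : V → Finset V) (m : ℕ) (hm : 0 < m)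
    (hconf : ∀ x ∈ F, (conf x).card ≤ m) (j : ℕ) (hj : j * m ≤ F.card) :
    ∃ f : Fin j → V, (∀ a, f a ∈ F) ∧ ∀ a b, a < b → f b ∉ conf (f a) := by
  induction j with
  | zero => exact ⟨fun a => a.elim0, fun a => a.elim0, fun a => a.elim0⟩
  | succ j ih =>
    rw [add_mul] at hj
    obtain ⟨f, hf, hc⟩ := ih (by omega)
    obtain ⟨x, hx, hxc⟩ : ∃ x ∈ F, x ∉ univ.biUnion fun a => conf (f a) := by
      by_contra! h
      have h1 : F.card ≤ _ := card_le_card h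
      have h2 := card_biUnion_le_card_mul univ (fun a => conf (f a)) m fun a _ => hconf _ (hf a)
      simp at h2
      omega
    simp only [mem_biUnion, mem_univ, true_and, not_exists] at hxc
    refine ⟨Fin.snoc f x, fun a => ?_, fun a b hab => ?_⟩
    · induction a using Fin.lastCases with
      | last => simpa using hx
      | cast a => simpa using hf a
    · induction a using Fin.lastCases with
      | last => exact absurd hab (by simp [Fin.le_last])
      | cast a =>
        induction b using Fin.lastCases with
        | last => simpa using hxc a
        | cast b => simpa using hc a b (by simpa using hab)

/-- A set of `k` vertices has a bijective coloring that gives one vertex a prescribed color. -/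
theorem exists_bijective_coloring {V : Type*} (S : Finset V) (hS : S.card = k) (x : V) (hx : x ∈ S)
    (i : Fin k) : ∃ g : V → Fin k, g x = i ∧ Set.InjOn g S ∧ ∀ j, ∃ y ∈ S, g y = j := by
  let φ : S ≃ Fin k := S.equivFinOfCardEq hS
  let ψ : S ≃ Fin k := φ.trans (Equiv.swap (φ ⟨x, hx⟩) i)
  have hψ : ∀ y (hy : y ∈ S), (fun y => if hy : y ∈ S then ψ ⟨y, hy⟩ else i) y = ψ ⟨y, hy⟩ :=
    fun y hy => dif_pos hy
  refine ⟨fun y => if hy : y ∈ S then ψ ⟨y, hy⟩ else i, ?_, fun u hu v hv huv => ?_, fun j => ?_⟩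
  · rw [hψ x hx]
    simp [ψ]
  · rw [hψ u hu, hψ v hv] at huv
    simpa using ψ.injective huv
  · exact ⟨ψ.symm j, (ψ.symm j).2, by rw [hψ _ (ψ.symm j).2]; simp⟩

/-- If `x₁, …, x_k` have degree `k - 1`, and their closed neighborhoods are disjoint from and
nonadjacent to each other and the vertices of degree at least `k`, then any coloring of `G` can be
changed into a coloring in which these vertices are b-vertices of the `k` colors. -/
theorem exists_coloring_of_scattered (c : G.Coloring (Fin k)) (f : Fin k → V)
    (hdeg : ∀ i, G.degree (f i) + 1 = k)
    (hfar : ∀ i, ∀ a ∈ closedNbhd G (f i), ∀ b ∈ closedNbhd G a, G.degree b < k)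
    (hsep : ∀ i j, i ≠ j → ∀ a ∈ closedNbhd G (f i), ∀ b ∈ closedNbhd G a,
      b ∉ closedNbhd G (f j)) :
    ∃ c' : G.Coloring (Fin k), ∀ i, c' (f i) = i ∧
      ∀ j, j ≠ i → ∃ y, G.Adj (f i) y ∧ c' y = j := by
  have hg : ∀ i, ∃ g : V → Fin k, g (f i) = i ∧ Set.InjOn g (closedNbhd G (f i)) ∧
      ∀ j, ∃ y ∈ closedNbhd G (f i), g y = j := fun i =>
    exists_bijective_coloring _ (by rw [card_closedNbhd, hdeg]) _ (self_mem_closedNbhd _) i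
  choose g hgx hginj hgsurj using hg
  have huniq : ∀ i j a, a ∈ closedNbhd G (f i) → a ∈ closedNbhd G (f j) → i = j := by
    intro i j a hi hj
    by_contra hij
    exact hsep i j hij a hi a (self_mem_closedNbhd a) hj
  let c₀ : V → Fin k := fun v => if h : ∃ i, v ∈ closedNbhd G (f i) then g h.choose v else c v
  have hc₀ : ∀ i, ∀ a ∈ closedNbhd G (f i), c₀ a = g i a := by
    intro i a ha
    have h : ∃ i, a ∈ closedNbhd G (f i) := ⟨i, ha⟩
    have : h.choose = i := huniq _ _ a h.choose_spec ha
    simp only [c₀, dif_pos h, this]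
  have hc₁ : ∀ a, k ≤ G.degree a → c₀ a = c a := by
    intro a ha
    refine dif_neg ?_
    rintro ⟨i, hi⟩
    exact absurd (hfar i a hi a (self_mem_closedNbhd a)) (by omega)
  obtain ⟨c', hc'⟩ := exists_coloring_extending (G := G)
    (univ.filter fun v => k ≤ G.degree v ∨ ∃ i, v ∈ closedNbhd G (f i)) c₀
    (by
      simp only [mem_filter, mem_univ, true_and]
      rintro u hu v hv huv
      have huv' : v ∈ closedNbhd G u := mem_closedNbhd.2 (Or.inr huv)
      have hvu' : u ∈ closedNbhd G v := mem_closedNbhd.2 (Or.inr huv.symm)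
      rcases hu with hu | ⟨i, hi⟩ <;> rcases hv with hv | ⟨j, hj⟩
      · rw [hc₁ u hu, hc₁ v hv]
        exact c.valid huv
      · exact absurd (hfar j v hj u hvu') (by omega)
      · exact absurd (hfar i u hi v huv') (by omega)
      · have hij : i = j := by
          by_contra hij
          exact hsep i j hij u hi v huv' hj
        subst hij
        rw [hc₀ i u hi, hc₀ i v hj]
        exact fun h => huv.ne (hginj i hi hj h))
    (fun v hv => by
      simp only [mem_filter, mem_univ, true_and, not_or] at hv
      omega)
  have hc'g : ∀ i, ∀ a ∈ closedNbhd G (f i), c' a = g i a := by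
    intro i a ha
    rw [hc' a (by simpa using Or.inr ⟨i, ha⟩), hc₀ i a ha]
  refine ⟨c', fun i => ⟨?_, fun j hj => ?_⟩⟩
  · rw [hc'g i _ (self_mem_closedNbhd _), hgx]
  · obtain ⟨y, hy, hyj⟩ := hgsurj i j
    refine ⟨y, (mem_closedNbhd.1 hy).resolve_left ?_, by rw [hc'g i y hy, hyj]⟩
    rintro rfl
    exact hj (by rw [← hyj, hgx])

/-- The vertices of degree at least `k`. -/
noncomputable def highSet (G : SimpleGraph V) (k : ℕ) : Finset V :=
  univ.filter fun v => k ≤ G.degree v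

theorem mem_highSet {v : V} : v ∈ highSet G k ↔ k ≤ G.degree v := by simp [highSet]

theorem card_highSet : (highSet G k).card = numHighDeg G k := rfl

theorem degree_le_maxDeg (v : V) : G.degree v ≤ maxDeg G := G.degree_le_maxDegree v

theorem card_biUnion_closedNbhd_le (S : Finset V) (m : ℕ) (h : ∀ v ∈ S, G.degree v + 1 ≤ m) :
    (S.biUnion (closedNbhd G)).card ≤ S.card * m :=
  card_biUnion_le_card_mul _ _ _ fun v hv => (card_closedNbhd v).trans_le (h v hv)

/-- The vertices of small degree whose closed neighborhood meets the closed neighborhood of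
`highSet G k`. -/
noncomputable def nearSet (G : SimpleGraph V) (k : ℕ) : Finset V :=
  univ.filter fun x => ∃ a ∈ closedNbhd G x, ∃ b ∈ closedNbhd G a, k ≤ G.degree b

theorem card_nearSet_le (hk : 1 ≤ k) :
    (nearSet G k).card ≤ numHighDeg G k * (maxDeg G + 1) * k := by
  set B := (highSet G k).biUnion (closedNbhd G) with hB
  have hBcard : B.card ≤ numHighDeg G k * (maxDeg G + 1) := by
    rw [← card_highSet]
    exact card_biUnion_closedNbhd_le _ _ fun v _ => Nat.succ_le_succ (degree_le_maxDeg v)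
  refine le_trans ?_ (Nat.mul_le_mul_right k hBcard)
  have hsub : nearSet G k ⊆ B.biUnion fun a => if k ≤ G.degree a then {a} else closedNbhd G a := by
    intro x hx
    simp only [nearSet, mem_filter, mem_univ, true_and] at hx
    obtain ⟨a, ha, b, hb, hbk⟩ := hx
    rw [mem_biUnion]
    by_cases hak : k ≤ G.degree a
    · have hxB : x ∈ B := mem_biUnion.2 ⟨a, mem_highSet.2 hak, mem_closedNbhd_comm.1 ha⟩
      refine ⟨x, hxB, ?_⟩
      split_ifs
      · exact mem_singleton_self x
      · exact self_mem_closedNbhd x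
    · refine ⟨a, mem_biUnion.2 ⟨b, mem_highSet.2 hbk, mem_closedNbhd_comm.1 hb⟩, ?_⟩
      rw [if_neg hak]
      exact mem_closedNbhd_comm.1 ha
  refine (card_le_card hsub).trans (card_biUnion_le_card_mul _ _ _ fun a _ => ?_)
  split_ifs with h
  · simpa using hk
  · rw [card_closedNbhd]
    omega

/-- Many vertices of degree `k - 1` make a b-coloring possible as soon as `G` is `k`-colorable, with
b-vertices among them. -/
theorem exists_coloring_of_many (hk : 1 ≤ k) (hkΔ : k ≤ maxDeg G + 1) (hΔ : 1 ≤ maxDeg G)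
    (Y : Finset V) (hY : ∀ y ∈ Y, G.degree y + 1 = k)
    (hcard : 2 * (k + numHighDeg G k) * k * k * maxDeg G ≤ Y.card) (c : G.Coloring (Fin k)) :
    ∃ c' : G.Coloring (Fin k), ∀ i, ∃ x ∈ Y, c' x = i ∧
      ∀ j, j ≠ i → ∃ y, G.Adj x y ∧ c' y = j := by
  set F := Y \ nearSet G k with hF
  have hFcard : k * (k * k * k) ≤ F.card := by
    have h1 := card_nearSet_le (G := G) hk
    have h2 : Y.card - (nearSet G k).card ≤ F.card := le_card_sdiff _ _
    have h3 : numHighDeg G k * (maxDeg G + 1) * k ≤ 2 * numHighDeg G k * k * k * maxDeg G :=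
      calc numHighDeg G k * (maxDeg G + 1) * k
          ≤ numHighDeg G k * (2 * maxDeg G) * (k * k) := by
            gcongr
            · omega
            · nlinarith
        _ = _ := by ring
    have h4 : k * (k * k * k) ≤ 2 * k * k * k * maxDeg G :=
      calc k * (k * k * k) ≤ (2 * maxDeg G) * (k * k * k) := by gcongr; omega
        _ = _ := by ring
    have h5 : 2 * (k + numHighDeg G k) * k * k * maxDeg G =
      2 * k * k * k * maxDeg G + 2 * numHighDeg G k * k * k * maxDeg G := by ring
    omega
  have hfar : ∀ x ∈ F, ∀ a ∈ closedNbhd G x, ∀ b ∈ closedNbhd G a, G.degree b < k := by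
    intro x hx a ha b hb
    by_contra! h
    exact (mem_sdiff.1 hx).2 (by simpa [nearSet] using ⟨a, ha, b, hb, h⟩)
  let conf : V → Finset V := fun x =>
    ((closedNbhd G x).biUnion (closedNbhd G)).biUnion (closedNbhd G)
  have hconf : ∀ x ∈ F, (conf x).card ≤ k * k * k := by
    intro x hx
    refine (card_biUnion_closedNbhd_le _ k fun b hb => ?_).trans (Nat.mul_le_mul_right k ?_)
    · obtain ⟨a, ha, hb⟩ := mem_biUnion.1 hb
      exact hfar x hx a ha b hb
    · refine (card_biUnion_closedNbhd_le _ k fun a ha => ?_).trans (Nat.mul_le_mul_right k ?_)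
      · exact hfar x hx a ha a (self_mem_closedNbhd a)
      · exact (card_closedNbhd x).trans_le (hY x (mem_sdiff.1 hx).1).le
  obtain ⟨f, hf, hfc⟩ := exists_conflict_free F conf (k * k * k) (by positivity) hconf k hFcard
  have hsep' : ∀ i j, i < j → ∀ a ∈ closedNbhd G (f i), ∀ b ∈ closedNbhd G a,
      b ∉ closedNbhd G (f j) := fun i j hij a ha b hb hbj =>
    hfc i j hij (mem_biUnion.2 ⟨b, mem_biUnion.2 ⟨a, ha, hb⟩, mem_closedNbhd_comm.1 hbj⟩)
  obtain ⟨c', hc'⟩ := exists_coloring_of_scattered c f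
    (fun i => hY _ (mem_sdiff.1 (hf i)).1) (fun i => hfar _ (hf i)) (by
      intro i j hij a ha b hb hbj
      rcases lt_or_gt_of_ne hij with h | h
      · exact hsep' i j h a ha b hb hbj
      · exact hsep' j i h b hbj a (mem_closedNbhd_comm.1 hb) ha)
  exact ⟨c', fun i => ⟨f i, (mem_sdiff.1 (hf i)).1, hc' i⟩⟩

/-- The subgraph induced by the closed neighborhood of a set `X` is an equivalent instance if `X`
consists of all vertices of degree at least `k` and sufficiently many vertices of degree
`k - 1`. -/
theorem hasBColoring_comap_iff {V' : Type*} (e : V' ↪ V)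
    (hk : 1 ≤ k) (hkΔ : k ≤ maxDeg G + 1) (hΔ : 1 ≤ maxDeg G) (X : Finset V)
    (he : ∀ v, v ∈ Set.range e ↔ ∃ x ∈ X, v ∈ closedNbhd G x)
    (hhigh : ∀ v, k ≤ G.degree v → v ∈ X)
    (hX : (∀ v, G.degree v + 1 = k → v ∈ X) ∨ 2 * (k + numHighDeg G k) * k * k * maxDeg G ≤
      (X.filter fun v => G.degree v + 1 = k).card) :
    HasBColoring G k ↔ HasBColoring (G.comap e) k := by
  refine ⟨?_, HasBColoring.of_comap e fun v hv => ?_⟩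
  · rintro ⟨c, hc⟩
    have hcomap : ∀ c : G.Coloring (Fin k), (∀ i, ∃ x ∈ X, c x = i ∧
        ∀ j, j ≠ i → ∃ y, G.Adj x y ∧ c y = j) → HasBColoring (G.comap e) k := fun c h =>
      HasBColoring.comap e c fun i =>
        let ⟨x, hx, hb⟩ := h i
        ⟨x, fun y hy => (he y).2 ⟨x, hx, hy⟩, hb⟩
    rcases hX with hX | hX
    · refine hcomap c fun i => ?_
      obtain ⟨x, rfl, hb⟩ := hc i
      have hd := le_degree_add_one_of_bVertex c hb
      refine ⟨x, ?_, rfl, hb⟩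
      by_cases h : k ≤ G.degree x
      · exact hhigh x h
      · exact hX x (by omega)
    · obtain ⟨c', hc'⟩ := exists_coloring_of_many hk hkΔ hΔ _
        (fun y hy => (mem_filter.1 hy).2) hX c
      refine hcomap c' fun i => ?_
      obtain ⟨x, hx, hb⟩ := hc' i
      exact ⟨x, (mem_filter.1 hx).1, hb⟩
  · by_contra! h
    exact hv ((he v).2 ⟨v, hhigh v h, self_mem_closedNbhd v⟩)

/-- The size of the closed neighborhood of a set of vertices of degree at least `k - 1`. -/
theorem card_kernel_le (X : Finset V) (hX : ∀ v ∈ X, k ≤ G.degree v + 1) {M : ℕ}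
    (hM : (X.filter fun v => G.degree v + 1 = k).card ≤ M) :
    (X.biUnion (closedNbhd G)).card ≤ numHighDeg G k * (maxDeg G + 1) + M * k := by
  have hsub : X ⊆ highSet G k ∪ X.filter fun v => G.degree v + 1 = k := by
    intro v hv
    have := hX v hv
    rw [mem_union, mem_highSet, mem_filter]
    by_cases h : k ≤ G.degree v
    · exact Or.inl h
    · exact Or.inr ⟨hv, by omega⟩
  refine (card_le_card (biUnion_subset_biUnion_of_subset_left _ hsub)).trans ?_
  rw [union_biUnion]
  refine (card_union_le _ _).trans (Nat.add_le_add ?_ ?_)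
  · rw [← card_highSet]
    exact card_biUnion_closedNbhd_le _ _ fun v _ => Nat.succ_le_succ (degree_le_maxDeg v)
  · refine (card_biUnion_closedNbhd_le _ k fun v hv => ?_).trans (Nat.mul_le_mul_right k hM)
    exact (mem_filter.1 hv).2.le

/-! ### Degenerate instances -/

theorem not_hasBColoring_of_lt (h : maxDeg G + 1 < k) : ¬ HasBColoring G k := by
  rintro ⟨c, hc⟩
  obtain ⟨x, hx, hb⟩ := hc ⟨0, by omega⟩
  rw [← hx] at hb
  have := le_degree_add_one_of_bVertex c hb
  have := degree_le_maxDeg (G := G) x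
  omega

theorem hasBColoring_zero_iff {V : Type*} {G : SimpleGraph V} : HasBColoring G 0 ↔ IsEmpty V :=
  ⟨fun ⟨c, _⟩ => ⟨fun v => (c v).elim0⟩, fun h =>
    ⟨SimpleGraph.Coloring.mk (fun v => (h.false v).elim) fun {v} => (h.false v).elim,
      fun i => i.elim0⟩⟩

theorem hasBColoring_one_iff (hΔ : maxDeg G = 0) : HasBColoring G 1 ↔ Nonempty V := by
  refine ⟨fun ⟨c, hc⟩ => ⟨(hc 0).choose⟩, fun ⟨v⟩ => ?_⟩
  refine ⟨SimpleGraph.Coloring.mk (fun _ => 0) fun {u w} huw => ?_, fun i =>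
    ⟨v, Subsingleton.elim _ _, fun j hj => (hj (Subsingleton.elim _ _)).elim⟩⟩
  have h1 : 0 < G.degree u := (G.degree_pos_iff_exists_adj u).2 ⟨w, huw⟩
  have h2 := degree_le_maxDeg (G := G) u
  omega

end Coloring

/-! ### Verification of programs of the random access machine -/

namespace Ram

/-- Started in state `s`, the program `p` halts after at most `T` steps in a state that
satisfies `Q`. -/
def Runs (p : Prog) (s : State) (T : ℕ) (Q : State → Prop) : Prop :=
  ∃ t s', Exec p s t s' ∧ t ≤ T ∧ Q s'

theorem Runs.mono {p : Prog} {s : State} {T T' : ℕ} {Q Q' : State → Prop} (h : Runs p s T Q)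
    (hT : T ≤ T') (hQ : ∀ s', Q s' → Q' s') : Runs p s T' Q' :=
  let ⟨t, s', he, ht, hq⟩ := h
  ⟨t, s', he, ht.trans hT, hQ s' hq⟩

theorem Runs.seq {p q : Prog} {s : State} {T T' : ℕ} {P Q : State → Prop} (hp : Runs p s T P)
    (hq : ∀ s', P s' → Runs q s' T' Q) : Runs (.seq p q) s (T + T') Q := by
  obtain ⟨t, s', he, ht, hP⟩ := hp
  obtain ⟨t', s'', he', ht', hQ⟩ := hq s' hP
  exact ⟨t + t', s'', .seq he he', Nat.add_le_add ht ht', hQ⟩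

theorem Runs.ite_pos {e : Expr} {p q : Prog} {s : State} {T : ℕ} {Q : State → Prop}
    (he : e.eval s ≠ 0) (hp : Runs p s T Q) : Runs (.ite e p q) s (e.cost + 1 + T) Q :=
  let ⟨_, s', h, ht, hq⟩ := hp
  ⟨_, s', .iteTrue he h, Nat.add_le_add_left ht _, hq⟩

theorem Runs.ite_neg {e : Expr} {p q : Prog} {s : State} {T : ℕ} {Q : State → Prop}
    (he : e.eval s = 0) (hq : Runs q s T Q) : Runs (.ite e p q) s (e.cost + 1 + T) Q :=
  let ⟨_, s', h, ht, hq⟩ := hq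
  ⟨_, s', .iteFalse he h, Nat.add_le_add_left ht _, hq⟩

theorem Runs.seq_le (T T' : ℕ) {T'' : ℕ} {p q : Prog} {s : State} {Q : State → Prop}
    (P : State → Prop) (hT : T + T' ≤ T'') (hp : Runs p s T P)
    (hq : ∀ s', P s' → Runs q s' T' Q) : Runs (.seq p q) s T'' Q :=
  (hp.seq hq).mono hT fun _ h => h

/-- The program contains no loops. -/
def Prog.straight : Prog → Bool
  | .seq p q => p.straight && q.straight
  | .ite _ p q => p.straight && q.straight
  | .loop _ _ => false
  | _ => true

/-- The effect of a program without loops. -/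
def Prog.run : Prog → State → State
  | .skip, s => s
  | .set r e, s => { s with reg := Function.update s.reg r (e.eval s) }
  | .put a i e, s =>
    { s with arr := Function.update s.arr a (Function.update (s.arr a) (i.eval s) (e.eval s)) }
  | .emit e, s => { s with out := s.out ++ [e.eval s] }
  | .seq p q, s => q.run (p.run s)
  | .ite e p q, s => if e.eval s ≠ 0 then p.run s else q.run s
  | .loop _ _, s => s

/-- A bound for the number of steps of a program without loops. -/
def Prog.cost : Prog → ℕ
  | .skip => 1
  | .set _ e => e.cost + 1
  | .put _ i e => i.cost + e.cost + 1
  | .emit e => e.cost + 1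
  | .seq p q => p.cost + q.cost
  | .ite e p q => e.cost + 1 + (p.cost + q.cost)
  | .loop _ _ => 0

theorem runs_straight {p : Prog} (hp : p.straight = true) {s : State} {Q : State → Prop}
    (hQ : Q (p.run s)) : Runs p s p.cost Q := by
  suffices h : Runs p s p.cost (· = p.run s) from h.mono le_rfl fun s' hs' => hs' ▸ hQ
  clear hQ Q
  induction p generalizing s with
  | skip => exact ⟨_, _, .skip s, le_rfl, rfl⟩
  | set r e => exact ⟨_, _, .set s r e, le_rfl, rfl⟩
  | put a i e => exact ⟨_, _, .put s a i e, le_rfl, rfl⟩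
  | emit e => exact ⟨_, _, .emit s e, le_rfl, rfl⟩
  | seq p q ihp ihq =>
    simp only [Prog.straight, Bool.and_eq_true] at hp
    exact (ihp hp.1).seq fun s' hs' => hs' ▸ ihq hp.2
  | ite e p q ihp ihq =>
    simp only [Prog.straight, Bool.and_eq_true] at hp
    by_cases he : e.eval s = 0
    · refine (Runs.ite_neg he (ihq hp.2)).mono ?_ ?_
      · simp [Prog.cost]
      · simp [Prog.run, he]
    · refine (Runs.ite_pos he (ihp hp.1)).mono ?_ ?_
      · simp [Prog.cost]
      · simp [Prog.run, he]
  | loop e p _ => simp [Prog.straight] at hp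

theorem runs_straight_le {p : Prog} {T : ℕ} (hp : p.straight = true) (hT : p.cost ≤ T) {s : State}
    {Q : State → Prop} (hQ : Q (p.run s)) : Runs p s T Q :=
  (runs_straight hp hQ).mono hT fun _ h => h

/-- The loop `for i = 0, …, e - 1 do p`. -/
def Prog.for (i : ℕ) (e : Expr) (p : Prog) : Prog :=
  .seq (.set i (.const 0))
    (.loop (.sub e (.reg i)) (.seq p (.set i (.add (.reg i) (.const 1)))))

/-- The state with a new value of one register. -/
def State.setReg (s : State) (r x : ℕ) : State := { s with reg := Function.update s.reg r x }

@[simp] theorem State.setReg_reg (s : State) (r x : ℕ) :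
    (s.setReg r x).reg = Function.update s.reg r x := rfl

@[simp] theorem State.setReg_arr (s : State) (r x : ℕ) : (s.setReg r x).arr = s.arr := rfl

@[simp] theorem State.setReg_out (s : State) (r x : ℕ) : (s.setReg r x).out = s.out := rfl

/-- The invariant rule for `for` loops. -/
theorem runs_for {i : ℕ} {e : Expr} {p : Prog} {s : State} {Q : State → Prop} {T : ℕ} (N : ℕ)
    (Inv : ℕ → State → Prop) (hinit : Inv 0 (s.setReg i 0))
    (heval : ∀ j s, Inv j s → e.eval s = N ∧ s.reg i = j)
    (hstep : ∀ j < N, ∀ s, Inv j s →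
      Runs p s T fun s' => s'.reg i = j ∧ Inv (j + 1) (s'.setReg i (j + 1)))
    (hQ : ∀ s, Inv N s → Q s) :
    Runs (.for i e p) s (N * (T + (e.cost + 7)) + (e.cost + 5)) Q := by
  have key : ∀ d j, j + d = N → ∀ s, Inv j s →
      Runs (.loop (.sub e (.reg i)) (.seq p (.set i (.add (.reg i) (.const 1))))) s
        (d * (T + (e.cost + 7)) + (e.cost + 3)) Q := by
    intro d
    induction d with
    | zero =>
      rintro j rfl s hs
      have := heval _ _ hs
      exact ⟨_, s, .loopDone (by simp [Expr.eval, this]), by simp [Expr.cost], hQ s hs⟩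
    | succ d ih =>
      rintro j hj s hs
      have hev := heval _ _ hs
      obtain ⟨t, s', he, ht, hi, hs'⟩ := hstep j (by omega) s hs
      obtain ⟨t', s'', he', ht', hq⟩ := ih (j + 1) (by omega) _ hs'
      have hset : Exec (.set i (.add (.reg i) (.const 1))) s' 4 (s'.setReg i (j + 1)) := by
        simpa [Expr.eval, Expr.cost, hi, State.setReg] using
          Exec.set s' i (.add (.reg i) (.const 1))
      refine ⟨_, s'', .loopStep ?_ (.seq he hset) he', ?_, hq⟩
      · simp only [Expr.eval, hev]
        omega
      · simp only [Expr.cost]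
        rw [add_mul]
        omega
  obtain ⟨t, s', he, ht, hq⟩ := key N 0 (by omega) _ hinit
  exact ⟨_, s', .seq (.set _ _ _) he, by simp only [Expr.cost]; omega, hq⟩

theorem runs_for_le {i : ℕ} {e : Expr} {p : Prog} {s : State} {Q : State → Prop} (T : ℕ) {T' : ℕ}
    (N : ℕ) (hT : N * (T + (e.cost + 7)) + (e.cost + 5) ≤ T')
    (Inv : ℕ → State → Prop) (hinit : Inv 0 (s.setReg i 0))
    (heval : ∀ j s, Inv j s → e.eval s = N ∧ s.reg i = j)
    (hstep : ∀ j < N, ∀ s, Inv j s →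
      Runs p s T fun s' => s'.reg i = j ∧ Inv (j + 1) (s'.setReg i (j + 1)))
    (hQ : ∀ s, Inv N s → Q s) : Runs (.for i e p) s T' Q :=
  (runs_for N Inv hinit heval hstep hQ).mono hT fun _ h => h

end Ram

/-! ### The numerical data of the kernelization -/

namespace BKernel

open Finset

/-- The degree of `u` in the graph on `{0, …, n - 1}` with adjacency matrix `a`. -/
def vdeg (n : ℕ) (a : ℕ → ℕ → ℕ) (u : ℕ) : ℕ := ∑ v ∈ range n, a u v

/-- The maximum degree of the first `m` vertices. -/
def maxDegUpTo (n : ℕ) (a : ℕ → ℕ → ℕ) (m : ℕ) : ℕ := (range m).sup (vdeg n a)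

/-- The number of vertices of degree at least `k` among the first `m` vertices. -/
def numHighUpTo (n k : ℕ) (a : ℕ → ℕ → ℕ) (m : ℕ) : ℕ := Nat.count (fun u => k ≤ vdeg n a u) m

/-- The number of vertices of degree `k - 1` among the first `m` vertices. -/
def numMidUpTo (n k : ℕ) (a : ℕ → ℕ → ℕ) (m : ℕ) : ℕ := Nat.count (fun u => vdeg n a u + 1 = k) m

/-- The number of vertices of degree `k - 1` that are kept. -/
def budget (n k : ℕ) (a : ℕ → ℕ → ℕ) : ℕ :=
  2 * (k + numHighUpTo n k a n) * k * k * maxDegUpTo n a n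

/-- The vertices whose closed neighborhoods form the kernel. -/
def IsSel (n k : ℕ) (a : ℕ → ℕ → ℕ) (u : ℕ) : Prop :=
  k ≤ vdeg n a u ∨ vdeg n a u + 1 = k ∧ numMidUpTo n k a u < budget n k a

/-- The vertices of the kernel. -/
def InKernel (n k : ℕ) (a : ℕ → ℕ → ℕ) (w : ℕ) : Prop :=
  ∃ u < n, IsSel n k a u ∧ (w = u ∨ a u w ≠ 0)

/-- The instances that are not decided at once. -/
def IsReducible (n k : ℕ) (a : ℕ → ℕ → ℕ) : Prop :=
  1 ≤ k ∧ 1 ≤ maxDegUpTo n a n ∧ k ≤ maxDegUpTo n a n + 1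

open Classical in
/-- The list of the vertices of the kernel. -/
noncomputable def kernelList (n k : ℕ) (a : ℕ → ℕ → ℕ) (m : ℕ) : List ℕ :=
  (List.range m).filter (InKernel n k a ·)

open Classical in
/-- The output of the kernelization. -/
noncomputable def output (n k : ℕ) (a : ℕ → ℕ → ℕ) : List ℕ :=
  if IsReducible n k a then
    2 :: (kernelList n k a n).length :: k ::
      (kernelList n k a n).flatMap fun u => (kernelList n k a n).map (a u)
  else [if k = min n 1 then 1 else 0]

/-! ### The program -/

open Ram

/-- Registers: 1 is `n`, 2 is `k`, 3 the position in the adjacency matrix, 4 and 5 the current row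
and column, 6 the current degree, 7 the maximum degree, 8 the number of vertices of large degree. The
degrees are stored in array 1. -/
def degreeProg : Prog :=
  .seq (.seq (.set 1 (.get 0 (.const 0))) (.seq (.set 2 (.get 0 (.const 1))) (.set 3 (.const 2))))
  (.for 4 (.reg 1)
    (.seq (.set 6 (.const 0))
    (.seq (.for 5 (.reg 1)
      (.seq (.set 6 (.add (.reg 6) (.get 0 (.reg 3)))) (.set 3 (.add (.reg 3) (.const 1)))))
    (.seq (.put 1 (.reg 4) (.reg 6))
    (.seq (.set 7 (.add (.reg 7) (.sub (.reg 6) (.reg 7))))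
      (.ite (.sub (.add (.reg 6) (.const 1)) (.reg 2)) (.set 8 (.add (.reg 8) (.const 1))) .skip))))))

/-- Multiply register 9 by register `r`. -/
def mulProg (r : ℕ) : Prog :=
  .seq (.set 11 (.const 0))
  (.seq (.for 13 (.reg r) (.set 11 (.add (.reg 11) (.reg 9))))
    (.set 9 (.reg 11)))

/-- Compute the budget in register 9. -/
def budgetProg : Prog :=
  .seq (.set 9 (.add (.add (.reg 2) (.reg 8)) (.add (.reg 2) (.reg 8))))
  (.seq (mulProg 2) (.seq (mulProg 2) (mulProg 7)))

/-- Mark the vertices of the kernel in array 2. Register 10 counts the vertices of degree `k - 1`,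
register 14 tells whether the current vertex is selected. -/
def markProg : Prog :=
  .seq (.set 3 (.const 2))
  (.for 4 (.reg 1)
    (.seq
      (.seq (.set 14 (.sub (.const 1) (.sub (.reg 2) (.get 1 (.reg 4)))))
      (.seq (.ite (.add (.sub (.reg 2) (.add (.get 1 (.reg 4)) (.const 1)))
          (.sub (.add (.get 1 (.reg 4)) (.const 1)) (.reg 2))) .skip
        (.seq (.ite (.sub (.reg 9) (.reg 10)) (.set 14 (.const 1)) .skip)
          (.set 10 (.add (.reg 10) (.const 1)))))
        (.ite (.reg 14) (.put 2 (.reg 4) (.const 1)) .skip)))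
      (.for 5 (.reg 1)
        (.seq (.ite (.reg 14) (.ite (.get 0 (.reg 3)) (.put 2 (.reg 5) (.const 1)) .skip) .skip)
          (.set 3 (.add (.reg 3) (.const 1)))))))

/-- Count the vertices of the kernel in register 12 and write the kernel. -/
def emitProg : Prog :=
  .seq (.for 4 (.reg 1) (.set 12 (.add (.reg 12) (.get 2 (.reg 4)))))
  (.seq (.seq (.emit (.const 2)) (.seq (.emit (.reg 12)) (.seq (.emit (.reg 2))
    (.set 3 (.const 2)))))
  (.for 4 (.reg 1)
    (.for 5 (.reg 1)
      (.seq (.ite (.get 2 (.reg 4)) (.ite (.get 2 (.reg 5)) (.emit (.get 0 (.reg 3))) .skip) .skip)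
        (.set 3 (.add (.reg 3) (.const 1)))))))

/-- Answer whether `k = min n 1`. -/
def decideProg : Prog :=
  .seq (.set 11 (.sub (.const 1) (.sub (.const 1) (.reg 1))))
    (.emit (.sub (.const 1) (.add (.sub (.reg 2) (.reg 11)) (.sub (.reg 11) (.reg 2)))))

/-- The kernelization algorithm. -/
def kernelProg : Prog :=
  .seq degreeProg
    (.ite (.sub (.const 1) (.add (.add (.sub (.const 1) (.reg 2)) (.sub (.const 1) (.reg 7)))
        (.sub (.reg 2) (.add (.reg 7) (.const 1)))))
      (.seq budgetProg (.seq markProg emitProg)) decideProg)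

/-! ### Correctness of the program -/

/-- `s` and `s₀` differ at most in the registers in `R`. -/
structure SameExcept (R : List ℕ) (s₀ s : State) : Prop where
  arr : s.arr = s₀.arr
  out : s.out = s₀.out
  reg : ∀ r ∉ R, s.reg r = s₀.reg r

/-- Array 0 holds the input. -/
structure IsInput (n k : ℕ) (a : ℕ → ℕ → ℕ) (A : ℕ → ℕ) : Prop where
  zero : A 0 = n
  one : A 1 = k
  adj : ∀ u < n, ∀ v < n, A (2 + u * n + v) = a u v

variable {n k : ℕ} {a : ℕ → ℕ → ℕ} {A : ℕ → ℕ}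

theorem runs_rowSum (hA : IsInput n k a A) {u : ℕ} (hu : u < n) (s₀ : State)
    (h0 : s₀.arr 0 = A) (h1 : s₀.reg 1 = n) (h3 : s₀.reg 3 = 2 + u * n) (h6 : s₀.reg 6 = 0) :
    Runs (.for 5 (.reg 1)
      (.seq (.set 6 (.add (.reg 6) (.get 0 (.reg 3)))) (.set 3 (.add (.reg 3) (.const 1)))))
      s₀ (n * 17 + 6) fun s => SameExcept [3, 5, 6] s₀ s ∧ s.reg 3 = 2 + (u + 1) * n ∧
        s.reg 6 = vdeg n a u := by
  refine runs_for (T := 9) n (fun v s => SameExcept [3, 5, 6] s₀ s ∧ s.reg 3 = 2 + u * n + v ∧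
    s.reg 5 = v ∧ s.reg 6 = ∑ w ∈ range v, a u w) ?_ ?_ ?_ ?_
  · refine ⟨⟨rfl, rfl, fun r hr => ?_⟩, ?_, ?_, ?_⟩
    · simp at hr
      simp [hr]
    · simpa using h3
    · simp
    · simpa using h6
  · rintro v s ⟨hs, h3', h5, h6'⟩
    exact ⟨by simpa [Expr.eval, hs.reg 1] using h1, h5⟩
  · rintro v hv s ⟨hs, h3', h5, h6'⟩
    refine runs_straight rfl ?_
    refine ⟨by simpa [Prog.run] using h5, ⟨hs.arr, hs.out, fun r hr => ?_⟩, ?_, ?_, ?_⟩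
    · have := hs.reg r hr
      simp at hr
      simpa [Prog.run, hr] using this
    · simp [Prog.run, Expr.eval, h3', add_assoc]
    · simp
    · simp [Prog.run, Expr.eval, h3', h6', hs.arr, h0, hA.adj u hu v hv, Finset.sum_range_succ]
  · rintro s ⟨hs, h3', h5, h6'⟩
    exact ⟨hs, by rw [h3']; ring, h6'⟩

/-- The state after `u` rounds of `degreeProg`. -/
structure DegreeInv (n k : ℕ) (a : ℕ → ℕ → ℕ) (A : ℕ → ℕ) (u : ℕ) (s : State) : Prop where
  input : s.arr 0 = A
  n_eq : s.reg 1 = n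
  k_eq : s.reg 2 = k
  deg : ∀ w < u, s.arr 1 w = vdeg n a w
  mark : s.arr 2 = 0
  maxDeg : s.reg 7 = maxDegUpTo n a u
  numHigh : s.reg 8 = numHighUpTo n k a u
  mid : s.reg 10 = 0
  count : s.reg 12 = 0
  out : s.out = []

theorem runs_degreeProg (hA : IsInput n k a A) (s₀ : State) (h0 : s₀.arr 0 = A)
    (hreg : ∀ r, r ≠ 0 → s₀.reg r = 0) (harr : s₀.arr 2 = 0) (hout : s₀.out = []) :
    Runs degreeProg s₀ (n * (n * 17 + 50) + 20) (DegreeInv n k a A n) := by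
  refine Runs.seq_le 8 (n * (n * 17 + 50) + 6) (fun s => DegreeInv n k a A 0 s ∧ s.reg 3 = 2)
    (by omega) (runs_straight_le rfl (by decide) ⟨?_, ?_⟩) fun s hs => runs_for_le (n * 17 + 42) n
      (by simp only [Expr.cost]; rfl)
      (fun u s => DegreeInv n k a A u s ∧ s.reg 3 = 2 + u * n ∧ s.reg 4 = u) ?_ ?_ ?_ ?_
  · constructor <;> simp [Prog.run, Expr.eval, h0, hA.zero, hA.one, hreg, harr, hout,
      maxDegUpTo, numHighUpTo]
  · simp [Prog.run, Expr.eval]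
  · obtain ⟨hs, h3⟩ := hs
    refine ⟨?_, by simpa using h3, by simp⟩
    constructor <;> simp [hs.input, hs.n_eq, hs.k_eq, hs.mark, hs.maxDeg, hs.numHigh, hs.mid,
      hs.count, hs.out]
  · rintro u s ⟨hs, h3, h4⟩
    exact ⟨by simpa [Expr.eval] using hs.n_eq, h4⟩
  · rintro u hu s ⟨hs, h3, h4⟩
    refine Runs.seq_le 2 (n * 17 + 40) (fun s => DegreeInv n k a A u s ∧
      s.reg 3 = 2 + u * n ∧ s.reg 4 = u ∧ s.reg 6 = 0) (by omega)
      (runs_straight_le rfl (by decide) ⟨?_, ?_, ?_, ?_⟩) fun s hs => ?_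
    · constructor <;> simp [Prog.run, hs.input, hs.n_eq, hs.k_eq, hs.mark, hs.maxDeg,
        hs.numHigh, hs.mid, hs.count, hs.out]
      exact hs.deg
    · simpa [Prog.run] using h3
    · simpa [Prog.run] using h4
    · simp [Prog.run, Expr.eval]
    · obtain ⟨hs, h3, h4, h6⟩ := hs
      refine Runs.seq_le (n * 17 + 6) 34 _ (by omega)
        (runs_rowSum hA hu s hs.input hs.n_eq h3 h6) fun s' hs' => ?_
      obtain ⟨hs', h3', h6'⟩ := hs'
      have h1' : s'.reg 1 = n := by rw [hs'.reg 1 (by simp), hs.n_eq]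
      have h4' : s'.reg 4 = u := by rw [hs'.reg 4 (by simp), h4]
      have h7' : s'.reg 7 = maxDegUpTo n a u := by rw [hs'.reg 7 (by simp), hs.maxDeg]
      have h8' : s'.reg 8 = numHighUpTo n k a u := by rw [hs'.reg 8 (by simp), hs.numHigh]
      have h2' : s'.reg 2 = k := by rw [hs'.reg 2 (by simp), hs.k_eq]
      have h10' : s'.reg 10 = 0 := by rw [hs'.reg 10 (by simp), hs.mid]
      have h12' : s'.reg 12 = 0 := by rw [hs'.reg 12 (by simp), hs.count]
      have hdel : maxDegUpTo n a (u + 1) =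
          maxDegUpTo n a u + (vdeg n a u - maxDegUpTo n a u) := by
        simp only [maxDegUpTo, Finset.range_add_one, Finset.sup_insert]
        rw [max_def]
        split_ifs <;> omega
      have hnum : numHighUpTo n k a (u + 1) =
          numHighUpTo n k a u + if vdeg n a u + 1 - k ≠ 0 then 1 else 0 := by
        rw [numHighUpTo, Nat.count_succ]
        congr 2
        apply propext
        omega
      refine runs_straight_le rfl (by decide) ?_
      by_cases hd : vdeg n a u + 1 - k = 0
      all_goals
        simp only [hd, ne_eq, not_true, not_false_eq_true, if_true, if_false] at hnum
        simp [Prog.run, Expr.eval, h2', h4', h6', h7', h8', hd, h3']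
        constructor <;> simp [hs'.arr, hs'.out, hs.input, hs.mark, hs.out, h1', h2', h8',
          h10', h12', hdel, hnum]
        intro w hw
        by_cases hwu : w = u
        · simp [hwu]
        · rw [Function.update_of_ne hwu, hs.deg w (by omega)]
  · rintro s ⟨hs, -⟩
    exact hs

theorem runs_mulProg (r : ℕ) (hr : r ∉ [9, 11, 13]) (s₀ : State) :
    Runs (mulProg r) s₀ (s₀.reg r * 12 + 10) fun s =>
      SameExcept [9, 11, 13] s₀ s ∧ s.reg 9 = s₀.reg 9 * s₀.reg r := by
  simp only [List.mem_cons, List.not_mem_nil, or_false, not_or] at hr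
  refine Runs.seq_le 2 (s₀.reg r * 12 + 8) (fun s => SameExcept [9, 11, 13] s₀ s ∧
    s.reg 9 = s₀.reg 9 ∧ s.reg 11 = 0) (by omega)
    (runs_straight_le rfl (by decide) ⟨⟨rfl, rfl, fun x hx => ?_⟩, rfl, by simp [Prog.run, Expr.eval]⟩)
    fun s hs => Runs.seq_le (s₀.reg r * 12 + 6) 2 (fun s => SameExcept [9, 11, 13] s₀ s ∧
    s.reg 11 = s₀.reg 9 * s₀.reg r) (by omega) (runs_for_le 4 (s₀.reg r) le_rfl
      (fun j s => SameExcept [9, 11, 13] s₀ s ∧ s.reg 9 = s₀.reg 9 ∧ s.reg 11 = s₀.reg 9 * j ∧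
        s.reg 13 = j) ?_ ?_ ?_ ?_) fun s hs => runs_straight_le rfl (by decide) ?_
  · simp at hx
    simp [Prog.run, hx]
  · obtain ⟨hs, h9, h11⟩ := hs
    refine ⟨⟨hs.arr, hs.out, fun x hx => ?_⟩, by simpa using h9, by simpa using h11, by simp⟩
    have := hs.reg x hx
    simp at hx
    simpa [hx] using this
  · rintro j s ⟨hs, h9, h11, h13⟩
    exact ⟨hs.reg r (by simpa using hr), h13⟩
  · rintro j hj s ⟨hs, h9, h11, h13⟩
    refine runs_straight_le rfl (by decide) ⟨by simpa [Prog.run] using h13,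
      ⟨hs.arr, hs.out, fun x hx => ?_⟩, by simpa [Prog.run] using h9, ?_, by simp⟩
    · have := hs.reg x hx
      simp at hx
      simpa [Prog.run, hx] using this
    · simp [Prog.run, Expr.eval, h9, h11, mul_add]
  · rintro s ⟨hs, -, h11, -⟩
    exact ⟨hs, h11⟩
  · obtain ⟨hs, h11⟩ := hs
    refine ⟨⟨hs.arr, hs.out, fun x hx => ?_⟩, by simpa [Prog.run, Expr.eval] using h11⟩
    have := hs.reg x hx
    simp at hx
    simpa [Prog.run, hx] using this

theorem runs_budgetProg (s₀ : State) :
    Runs budgetProg s₀ (s₀.reg 2 * 24 + s₀.reg 7 * 12 + 40) fun s =>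
      SameExcept [9, 11, 13] s₀ s ∧
        s.reg 9 = 2 * (s₀.reg 2 + s₀.reg 8) * s₀.reg 2 * s₀.reg 2 * s₀.reg 7 := by
  refine Runs.seq_le 8 (s₀.reg 2 * 24 + s₀.reg 7 * 12 + 32) (fun s => SameExcept [9, 11, 13] s₀ s ∧
    s.reg 9 = 2 * (s₀.reg 2 + s₀.reg 8)) (by omega) (runs_straight_le rfl (by decide)
      ⟨⟨rfl, rfl, fun x hx => ?_⟩, by simp [Prog.run, Expr.eval, two_mul]⟩) fun s ⟨hs, h9⟩ => ?_
  · simp at hx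
    simp [Prog.run, hx]
  have h2 := hs.reg 2 (by simp)
  refine Runs.seq_le (s₀.reg 2 * 12 + 10) (s₀.reg 2 * 12 + s₀.reg 7 * 12 + 22) _ (by omega)
    ((runs_mulProg 2 (by simp) s).mono (by rw [h2]) fun _ h => h) fun s' ⟨hs', h9'⟩ => ?_
  have h2' := hs'.reg 2 (by simp)
  refine Runs.seq_le (s₀.reg 2 * 12 + 10) (s₀.reg 7 * 12 + 12) _ (by omega)
    ((runs_mulProg 2 (by simp) s').mono (by rw [h2', h2]) fun _ h => h) fun s'' ⟨hs'', h9''⟩ => ?_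
  have h7 : s''.reg 7 = s₀.reg 7 := by
    rw [hs''.reg 7 (by simp), hs'.reg 7 (by simp), hs.reg 7 (by simp)]
  refine (runs_mulProg 7 (by simp) s'').mono (by rw [h7]; omega) fun s₃ ⟨hs₃, h9₃⟩ =>
    ⟨⟨?_, ?_, fun r hr => ?_⟩, ?_⟩
  · rw [hs₃.arr, hs''.arr, hs'.arr, hs.arr]
  · rw [hs₃.out, hs''.out, hs'.out, hs.out]
  · rw [hs₃.reg r hr, hs''.reg r hr, hs'.reg r hr, hs.reg r hr]
  · rw [h9₃, h9'', h9', h9, h7, h2', h2]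

/-- The state of `markProg` when it has met `c` vertices of degree `k - 1` and has marked the
set `W`. -/
structure MarkInv (n k : ℕ) (a : ℕ → ℕ → ℕ) (A : ℕ → ℕ) (c : ℕ) (W : ℕ → Prop) (s : State) :
    Prop where
  input : s.arr 0 = A
  n_eq : s.reg 1 = n
  k_eq : s.reg 2 = k
  deg : ∀ w < n, s.arr 1 w = vdeg n a w
  mark : ∀ w < n, W w → s.arr 2 w = 1
  unmark : ∀ w < n, ¬ W w → s.arr 2 w = 0
  budget_eq : s.reg 9 = budget n k a
  mid : s.reg 10 = c
  count : s.reg 12 = 0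
  out : s.out = []

theorem MarkInv.congr {c : ℕ} {W W' : ℕ → Prop} {s : State} (h : MarkInv n k a A c W s)
    (hW : ∀ w < n, W w ↔ W' w) : MarkInv n k a A c W' s :=
  { h with
    mark := fun w hw hw' => h.mark w hw ((hW w hw).2 hw')
    unmark := fun w hw hw' => h.unmark w hw fun hh => hw' ((hW w hw).1 hh) }

theorem MarkInv.setReg {c : ℕ} {W : ℕ → Prop} {s : State} (h : MarkInv n k a A c W s) {r : ℕ}
    (hr : r ∈ [3, 4, 5, 14]) (x : ℕ) : MarkInv n k a A c W (s.setReg r x) := by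
  obtain ⟨h0, h1, h2, h3, h4, h5, h6, h7, h8, h9⟩ := h
  simp only [List.mem_cons, List.not_mem_nil, or_false] at hr
  refine ⟨h0, ?_, ?_, h3, h4, h5, ?_, ?_, ?_, h9⟩ <;>
  · simp only [State.setReg_reg]
    rw [Function.update_of_ne (by omega)]
    assumption

theorem runs_markRow (hA : IsInput n k a A) {u c : ℕ} (hu : u < n) (W : ℕ → Prop) (S : Prop)
    (s₀ : State) (hinv : MarkInv n k a A c W s₀) (h3 : s₀.reg 3 = 2 + u * n) (h4 : s₀.reg 4 = u)
    (hS : s₀.reg 14 ≠ 0 ↔ S) :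
    Runs (.for 5 (.reg 1)
        (.seq (.ite (.reg 14) (.ite (.get 0 (.reg 3)) (.put 2 (.reg 5) (.const 1)) .skip) .skip)
          (.set 3 (.add (.reg 3) (.const 1))))) s₀ (n * 25 + 6) fun s =>
      MarkInv n k a A c (fun w => W w ∨ S ∧ a u w ≠ 0) s ∧ s.reg 3 = 2 + (u + 1) * n ∧
        s.reg 4 = u := by
  refine runs_for_le 17 n le_rfl (fun v s => MarkInv n k a A c
      (fun w => W w ∨ S ∧ w < v ∧ a u w ≠ 0) s ∧ s.reg 3 = 2 + u * n + v ∧ s.reg 4 = u ∧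
      s.reg 5 = v ∧ (s.reg 14 ≠ 0 ↔ S)) ?_ ?_ ?_ ?_
  · exact ⟨(hinv.congr (by simp)).setReg (by simp) 0, by simpa using h3, by simpa using h4,
      by simp, by simpa using hS⟩
  · rintro v s ⟨hs, -, -, h5, -⟩
    exact ⟨hs.n_eq, h5⟩
  · rintro v hv s ⟨hs, h3', h4', h5', hS'⟩
    have hget : s.arr 0 (s.reg 3) = a u v := by rw [hs.input, h3', hA.adj u hu v hv]
    refine runs_straight_le rfl (by decide) ?_
    by_cases hmark : S ∧ a u v ≠ 0
    · have h14 := hS'.2 hmark.1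
      simp only [Prog.run, Expr.eval, hget, h14, hmark.2, ne_eq, not_false_eq_true, if_true]
      refine ⟨by simpa using h5', ⟨?_, ?_, ?_, ?_, fun w hw hW => ?_, fun w hw hW => ?_, ?_, ?_, ?_,
        ?_⟩, by simp [h3', add_assoc], by simpa using h4', by simp, by simpa using hS'⟩
      · simp [hs.input]
      · simp [hs.n_eq]
      · simp [hs.k_eq]
      · simpa using hs.deg
      · by_cases hwv : w = v
        · simp [hwv, h5']
        · simp only [State.setReg_arr, Function.update_self, h5', Function.update_of_ne hwv]
          refine hs.mark w hw (hW.imp_right fun h => ⟨h.1, by omega, h.2.2⟩)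
      · simp only [not_or] at hW
        have hwv : w ≠ v := by
          rintro rfl
          exact hW.2 ⟨hmark.1, by omega, hmark.2⟩
        simp only [State.setReg_arr, Function.update_self, h5', Function.update_of_ne hwv]
        exact hs.unmark w hw fun h => h.elim hW.1 fun h => hW.2 ⟨h.1, by omega, h.2.2⟩
      · simp [hs.budget_eq]
      · simp [hs.mid]
      · simp [hs.count]
      · simp [hs.out]
    · have hrun : ((Prog.ite (.reg 14) (.ite (.get 0 (.reg 3)) (.put 2 (.reg 5) (.const 1)) .skip)
          .skip).run s) = s := by
        simp only [Prog.run, Expr.eval, hget]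
        by_cases h1 : s.reg 14 ≠ 0
        · rw [if_pos h1, if_neg fun h2 => hmark ⟨hS'.1 h1, h2⟩]
        · rw [if_neg h1]
      rw [Prog.run, hrun]
      have hcongr := hs.congr (W' := fun w => W w ∨ S ∧ w < v + 1 ∧ a u w ≠ 0) fun w hw =>
        or_congr_right ⟨fun h => ⟨h.1, by omega, h.2.2⟩, fun h => ⟨h.1, by
          by_contra hwv
          obtain rfl : w = v := by omega
          exact hmark ⟨h.1, h.2.2⟩, h.2.2⟩⟩
      exact ⟨by simpa [Prog.run] using h5', (hcongr.setReg (by simp) _).setReg (by simp) _,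
        by simp [Prog.run, Expr.eval, h3', add_assoc], by simpa [Prog.run] using h4', by simp,
        by simpa [Prog.run] using hS'⟩
  · rintro s ⟨hs, h3', h4', -, -⟩
    exact ⟨hs.congr fun w hw => by simp [hw], by rw [h3']; ring, h4'⟩

theorem runs_select {u : ℕ} (hu : u < n) (W : ℕ → Prop) (s₀ : State)
    (hinv : MarkInv n k a A (numMidUpTo n k a u) W s₀) (h3 : s₀.reg 3 = 2 + u * n)
    (h4 : s₀.reg 4 = u) :
    Runs (.seq (.set 14 (.sub (.const 1) (.sub (.reg 2) (.get 1 (.reg 4)))))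
      (.seq (.ite (.add (.sub (.reg 2) (.add (.get 1 (.reg 4)) (.const 1)))
          (.sub (.add (.get 1 (.reg 4)) (.const 1)) (.reg 2))) .skip
        (.seq (.ite (.sub (.reg 9) (.reg 10)) (.set 14 (.const 1)) .skip)
          (.set 10 (.add (.reg 10) (.const 1)))))
        (.ite (.reg 14) (.put 2 (.reg 4) (.const 1)) .skip))) s₀ 43 fun s =>
      MarkInv n k a A (numMidUpTo n k a (u + 1)) (fun w => W w ∨ IsSel n k a u ∧ w = u) s ∧
        s.reg 3 = 2 + u * n ∧ s.reg 4 = u ∧ (s.reg 14 ≠ 0 ↔ IsSel n k a u) := by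
  have hnum : numMidUpTo n k a (u + 1) =
      numMidUpTo n k a u + if vdeg n a u + 1 = k then 1 else 0 := Nat.count_succ _ _
  refine Runs.seq_le 8 35 (fun s => MarkInv n k a A (numMidUpTo n k a u) W s ∧
    s.reg 3 = 2 + u * n ∧ s.reg 4 = u ∧ (s.reg 14 ≠ 0 ↔ k ≤ vdeg n a u)) (by omega)
    (runs_straight_le rfl (by decide) ⟨hinv.setReg (by simp) _, by simpa [Prog.run] using h3,
      by simpa [Prog.run] using h4, ?_⟩) fun s ⟨hs, h3, h4, h14⟩ => ?_
  · simp only [Prog.run, Expr.eval, Function.update_self, h4, hinv.deg u hu, hinv.k_eq]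
    omega
  refine Runs.seq_le 27 7 (fun s => MarkInv n k a A (numMidUpTo n k a (u + 1)) W s ∧
    s.reg 3 = 2 + u * n ∧ s.reg 4 = u ∧ (s.reg 14 ≠ 0 ↔ IsSel n k a u)) (by omega)
    (runs_straight_le rfl (by decide) ?_) fun s ⟨hs, h3, h4, h14⟩ =>
      runs_straight_le rfl (by decide) ?_
  · simp only [Prog.run, Expr.eval, h4, hs.deg u hu, hs.k_eq, hs.budget_eq, hs.mid]
    by_cases hmid : vdeg n a u + 1 = k
    · rw [if_pos hmid] at hnum
      have hsel : IsSel n k a u ↔ numMidUpTo n k a u < budget n k a := by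
        simp only [IsSel, hmid, true_and, or_iff_right_iff_imp]
        omega
      rw [if_neg (by omega)]
      by_cases hb : numMidUpTo n k a u < budget n k a
      · rw [if_pos (by omega), hnum]
        refine ⟨⟨?_, ?_, ?_, ?_, ?_, ?_, ?_, ?_, ?_, ?_⟩, by simpa using h3, by simpa using h4,
          by simpa using hsel.2 hb⟩
        · simp [hs.input]
        · simp [hs.n_eq]
        · simp [hs.k_eq]
        · simpa using hs.deg
        · simpa using hs.mark
        · simpa using hs.unmark
        · simp [hs.budget_eq]
        · simp [hs.mid]
        · simp [hs.count]
        · simp [hs.out]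
      · rw [if_neg (by omega), hnum]
        refine ⟨⟨?_, ?_, ?_, ?_, ?_, ?_, ?_, ?_, ?_, ?_⟩, by simpa using h3, by simpa using h4, ?_⟩
        · simp [hs.input]
        · simp [hs.n_eq]
        · simp [hs.k_eq]
        · simpa using hs.deg
        · simpa using hs.mark
        · simpa using hs.unmark
        · simp [hs.budget_eq]
        · simp [hs.mid]
        · simp [hs.count]
        · simp [hs.out]
        · have hlt : ¬ k ≤ vdeg n a u := by omega
          exact iff_of_false (fun h => hlt (h14.1 h)) fun h => hb (hsel.1 h)
    · rw [if_neg hmid, add_zero] at hnum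
      rw [if_pos (by omega), hnum]
      exact ⟨hs, h3, h4, by simp [h14, IsSel, hmid]⟩
  · simp only [Prog.run, Expr.eval, h4]
    by_cases hsel : IsSel n k a u
    · rw [if_pos (h14.2 hsel)]
      refine ⟨⟨?_, hs.n_eq, hs.k_eq, ?_, fun w hw hW => ?_, fun w hw hW => ?_, hs.budget_eq,
        hs.mid, hs.count, hs.out⟩, h3, h4, h14⟩
      · simp [hs.input]
      · simpa using hs.deg
      · by_cases hwu : w = u
        · simp [hwu]
        · simp only [Function.update_self, Function.update_of_ne hwu]
          exact hs.mark w hw (hW.resolve_right fun h => hwu h.2)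
      · simp only [not_or] at hW
        simp only [Function.update_self, Function.update_of_ne fun h => hW.2 ⟨hsel, h⟩]
        exact hs.unmark w hw hW.1
    · rw [if_neg (by rwa [h14])]
      exact ⟨hs.congr (by simp [hsel]), h3, h4, h14⟩

theorem runs_markProg (hA : IsInput n k a A) (s₀ : State)
    (hinv : MarkInv n k a A 0 (fun _ => False) s₀) :
    Runs markProg s₀ (n * (n * 25 + 60) + 20) (MarkInv n k a A (numMidUpTo n k a n)
      (InKernel n k a)) := by
  refine Runs.seq_le 2 (n * (n * 25 + 60) + 6) (fun s => MarkInv n k a A 0 (fun _ => False) s ∧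
    s.reg 3 = 2) (by omega) (runs_straight_le rfl (by decide)
      ⟨hinv.setReg (by simp) _, by simp [Prog.run, Expr.eval]⟩) fun s ⟨hs, h3⟩ =>
    runs_for_le (n * 25 + 49) n (by simp only [Expr.cost]; linarith)
      (fun u s => MarkInv n k a A (numMidUpTo n k a u)
        (fun w => ∃ u' < u, IsSel n k a u' ∧ (w = u' ∨ a u' w ≠ 0)) s ∧
        s.reg 3 = 2 + u * n ∧ s.reg 4 = u) ?_ ?_ ?_ ?_
  · refine ⟨(hs.congr (by simp)).setReg (by simp) 0, by simpa using h3, by simp⟩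
  · rintro u s ⟨hs, -, h4⟩
    exact ⟨hs.n_eq, h4⟩
  · rintro u hu s ⟨hs, h3, h4⟩
    have hW : ∀ w < n, ((∃ u' < u, IsSel n k a u' ∧ (w = u' ∨ a u' w ≠ 0)) ∨
        IsSel n k a u ∧ w = u) ∨ IsSel n k a u ∧ a u w ≠ 0 ↔
        ∃ u' < u + 1, IsSel n k a u' ∧ (w = u' ∨ a u' w ≠ 0) := by
      intro w _
      rw [or_assoc, ← and_or_left]
      simp only [Nat.lt_succ_iff_lt_or_eq, or_and_right, exists_or, exists_eq_left]
    refine Runs.seq_le 43 (n * 25 + 6) (fun s => MarkInv n k a A (numMidUpTo n k a (u + 1))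
      (fun w => (∃ u' < u, IsSel n k a u' ∧ (w = u' ∨ a u' w ≠ 0)) ∨ IsSel n k a u ∧ w = u) s ∧
        s.reg 3 = 2 + u * n ∧ s.reg 4 = u ∧ (s.reg 14 ≠ 0 ↔ IsSel n k a u)) (by omega)
      (runs_select hu _ s hs h3 h4) ?_
    rintro s ⟨hs, h3, h4, h14⟩
    refine (runs_markRow hA hu _ _ s hs h3 h4 h14).mono le_rfl ?_
    rintro s ⟨hs, h3, h4⟩
    exact ⟨h4, (hs.congr hW).setReg (by simp) _, by simpa using h3, by simp⟩
  · rintro s ⟨hs, -, -⟩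
    exact hs

/-! #### The output -/

theorem kernelList_zero : kernelList n k a 0 = [] := rfl

theorem kernelList_succ_pos {m : ℕ} (h : InKernel n k a m) :
    kernelList n k a (m + 1) = kernelList n k a m ++ [m] := by
  simp [kernelList, List.range_succ, h]

theorem kernelList_succ_neg {m : ℕ} (h : ¬ InKernel n k a m) :
    kernelList n k a (m + 1) = kernelList n k a m := by
  simp [kernelList, List.range_succ, h]

/-- The state of `emitProg` with output `o`. -/
structure EmitInv (n k : ℕ) (a : ℕ → ℕ → ℕ) (A : ℕ → ℕ) (o : List ℕ) (s : State) :
    Prop where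
  input : s.arr 0 = A
  n_eq : s.reg 1 = n
  k_eq : s.reg 2 = k
  mark : ∀ w < n, InKernel n k a w → s.arr 2 w = 1
  unmark : ∀ w < n, ¬ InKernel n k a w → s.arr 2 w = 0
  out : s.out = o

theorem EmitInv.setReg {o : List ℕ} {s : State} (h : EmitInv n k a A o s) {r : ℕ}
    (hr : r ∈ [3, 4, 5, 12]) (x : ℕ) : EmitInv n k a A o (s.setReg r x) := by
  obtain ⟨h0, h1, h2, h3, h4, h5⟩ := h
  simp only [List.mem_cons, List.not_mem_nil, or_false] at hr
  refine ⟨h0, ?_, ?_, h3, h4, h5⟩ <;>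
  · simp only [State.setReg_reg]
    rw [Function.update_of_ne (by omega)]
    assumption

theorem EmitInv.emit {o : List ℕ} {s : State} (h : EmitInv n k a A o s) {e : Expr} {x : ℕ}
    (hx : e.eval s = x) : EmitInv n k a A (o ++ [x]) ((Prog.emit e).run s) :=
  ⟨h.input, h.n_eq, h.k_eq, h.mark, h.unmark, by simp [Prog.run, h.out, hx]⟩

open Classical in
theorem runs_emitRow (hA : IsInput n k a A) {u : ℕ} (hu : u < n) (o : List ℕ)
    (s₀ : State) (hinv : EmitInv n k a A o s₀) (h3 : s₀.reg 3 = 2 + u * n) (h4 : s₀.reg 4 = u) :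
    Runs (.for 5 (.reg 1)
        (.seq (.ite (.get 2 (.reg 4)) (.ite (.get 2 (.reg 5)) (.emit (.get 0 (.reg 3))) .skip) .skip)
        (.set 3 (.add (.reg 3) (.const 1))))) s₀ (n * 25 + 6) fun s =>
      EmitInv n k a A (o ++ if InKernel n k a u then (kernelList n k a n).map (a u) else []) s ∧
        s.reg 3 = 2 + (u + 1) * n ∧ s.reg 4 = u := by
  refine runs_for_le 17 n le_rfl (fun v s => EmitInv n k a A
      (o ++ if InKernel n k a u then (kernelList n k a v).map (a u) else []) s ∧
      s.reg 3 = 2 + u * n + v ∧ s.reg 4 = u ∧ s.reg 5 = v) ?_ ?_ ?_ ?_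
  · exact ⟨by simpa [kernelList_zero] using hinv.setReg (r := 5) (by simp) 0, by simpa using h3,
      by simpa using h4, by simp⟩
  · rintro v s ⟨hs, -, -, h5⟩
    exact ⟨hs.n_eq, h5⟩
  · rintro v hv s ⟨hs, h3', h4', h5'⟩
    refine Runs.seq_le 13 4 (fun s => EmitInv n k a A
      (o ++ if InKernel n k a u then (kernelList n k a (v + 1)).map (a u) else []) s ∧
      s.reg 3 = 2 + u * n + v ∧ s.reg 4 = u ∧ s.reg 5 = v) (by omega)
      (runs_straight_le rfl (by decide) ?_) fun s ⟨hs, h3', h4', h5'⟩ =>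
        runs_straight_le rfl (by decide) ⟨by simpa [Prog.run] using h5',
          (hs.setReg (by simp) _).setReg (by simp) _,
          by simp [Prog.run, Expr.eval, h3', add_assoc], by simpa [Prog.run] using h4', by simp⟩
    have hget : s.arr 0 (s.reg 3) = a u v := by rw [hs.input, h3', hA.adj u hu v hv]
    by_cases h1 : InKernel n k a u
    · have hm := hs.mark u hu h1
      simp only [h1, if_true] at hs ⊢
      by_cases h2 : InKernel n k a v
      · simp only [Prog.run.eq_6, Prog.run.eq_1, Expr.eval, h4', h5', hm, hs.mark v hv h2, ne_eq,
          one_ne_zero, not_false_eq_true, if_true, kernelList_succ_pos h2]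
        refine ⟨?_, h3', h4', h5'⟩
        simpa using hs.emit (e := .get 0 (.reg 3)) hget
      · simp only [Prog.run.eq_6, Prog.run.eq_1, Expr.eval, h4', h5', hm, hs.unmark v hv h2, ne_eq,
          one_ne_zero, not_false_eq_true, if_true, not_true, if_false, kernelList_succ_neg h2]
        exact ⟨hs, h3', trivial, trivial⟩
    · simp only [h1, if_false] at hs ⊢
      simp only [Prog.run.eq_6, Prog.run.eq_1, Expr.eval, h4', hs.unmark u hu h1, ne_eq, not_true,
        if_false]
      exact ⟨hs, h3', trivial, h5'⟩
  · rintro s ⟨hs, h3', h4', -⟩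
    exact ⟨hs, by rw [h3']; ring, h4'⟩

theorem runs_emitProg (hA : IsInput n k a A) (s₀ : State) (hinv : EmitInv n k a A [] s₀)
    (h12 : s₀.reg 12 = 0) :
    Runs emitProg s₀ (n * (n * 25 + 40) + 30) fun s =>
      s.out = 2 :: (kernelList n k a n).length :: k ::
        (kernelList n k a n).flatMap fun u => (kernelList n k a n).map (a u) := by
  refine Runs.seq_le (n * 13 + 6) (n * (n * 25 + 20) + 14) (fun s => EmitInv n k a A [] s ∧
    s.reg 12 = (kernelList n k a n).length) (by linarith) (runs_for_le 5 n le_rfl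
      (fun u s => EmitInv n k a A [] s ∧ s.reg 12 = (kernelList n k a u).length ∧ s.reg 4 = u)
      ?_ ?_ ?_ ?_) fun s ⟨hs, h12⟩ => ?_
  · exact ⟨hinv.setReg (by simp) _, by simpa [kernelList_zero] using h12, by simp⟩
  · rintro u s ⟨hs, -, h4⟩
    exact ⟨hs.n_eq, h4⟩
  · rintro u hu s ⟨hs, h12, h4⟩
    refine runs_straight_le rfl (by decide) ⟨by simpa [Prog.run] using h4,
      (hs.setReg (by simp) _).setReg (by simp) _, ?_, by simp⟩
    by_cases h : InKernel n k a u
    · simp [Prog.run, Expr.eval, h12, h4, hs.mark u hu h, kernelList_succ_pos h]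
    · simp [Prog.run, Expr.eval, h12, h4, hs.unmark u hu h, kernelList_succ_neg h]
  · rintro s ⟨hs, h12, -⟩
    exact ⟨hs, h12⟩
  refine Runs.seq_le 8 (n * (n * 25 + 20) + 6) (fun s => EmitInv n k a A
    [2, (kernelList n k a n).length, k] s ∧ s.reg 3 = 2) (by omega)
    (runs_straight_le rfl (by decide) ⟨?_, by simp [Prog.run, Expr.eval]⟩) fun s ⟨hs, h3⟩ =>
      runs_for_le (n * 25 + 6) n (by simp only [Expr.cost]; linarith)
      (fun u s => EmitInv n k a A ([2, (kernelList n k a n).length, k] ++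
        (kernelList n k a u).flatMap fun u => (kernelList n k a n).map (a u)) s ∧
        s.reg 3 = 2 + u * n ∧ s.reg 4 = u) ?_ ?_ ?_ ?_
  · exact (((hs.emit (e := .const 2) rfl).emit (e := .reg 12) h12).emit (e := .reg 2)
      hs.k_eq).setReg (by simp) _
  · exact ⟨hs.setReg (by simp) _, by simpa using h3, by simp⟩
  · rintro u s ⟨hs, -, h4⟩
    exact ⟨hs.n_eq, h4⟩
  · rintro u hu s ⟨hs, h3, h4⟩
    refine (runs_emitRow hA hu _ s hs h3 h4).mono le_rfl fun s ⟨hs, h3, h4⟩ =>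
      ⟨h4, EmitInv.setReg ?_ (by simp) _, by simpa using h3, by simp⟩
    by_cases h : InKernel n k a u
    · rw [kernelList_succ_pos h]
      simpa [h] using hs
    · rw [kernelList_succ_neg h]
      simpa [h] using hs
  · rintro s ⟨hs, -, -⟩
    simpa using hs.out

theorem maxDegUpTo_le (ha : ∀ u v, a u v ≤ 1) (m : ℕ) : maxDegUpTo n a m ≤ n :=
  Finset.sup_le fun u _ => (Finset.sum_le_card_nsmul _ _ 1 fun v _ => ha u v).trans (by simp)

theorem runs_kernelProg (ha : ∀ u v, a u v ≤ 1) (hA : IsInput n k a A) (s₀ : State)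
    (h0 : s₀.arr 0 = A) (hreg : ∀ r, r ≠ 0 → s₀.reg r = 0) (harr : s₀.arr 2 = 0)
    (hout : s₀.out = []) :
    Runs kernelProg s₀ (200 * (n + 1) * (n + 1)) fun s => s.out = output n k a := by
  refine Runs.seq_le (n * (n * 17 + 50) + 20) (n * (n * 50 + 136) + 154) _ (by nlinarith)
    (runs_degreeProg hA s₀ h0 hreg harr hout) fun s hs => ?_
  have htest : (Expr.sub (.const 1) (.add (.add (.sub (.const 1) (.reg 2))
      (.sub (.const 1) (.reg 7))) (.sub (.reg 2) (.add (.reg 7) (.const 1))))).eval s ≠ 0 ↔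
      IsReducible n k a := by
    simp only [Expr.eval, hs.k_eq, hs.maxDeg, IsReducible]
    omega
  by_cases hred : IsReducible n k a
  · refine (Runs.ite_pos (htest.2 hred) (T := n * (n * 50 + 136) + 138) ?_).mono
      (by simp only [Expr.cost]; omega) fun _ h => h
    have hk : k ≤ n + 1 := hred.2.2.trans (Nat.succ_le_succ (maxDegUpTo_le ha n))
    have hΔ := maxDegUpTo_le (n := n) ha n
    refine Runs.seq_le (n * 36 + 64) (n * (n * 50 + 100) + 50) _ (by linarith)
      ((runs_budgetProg s).mono (by rw [hs.k_eq, hs.maxDeg]; omega) fun _ h => h)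
      fun s' ⟨hs', h9⟩ => ?_
    refine Runs.seq_le (n * (n * 25 + 60) + 20) (n * (n * 25 + 40) + 30) _ (by linarith)
      (runs_markProg hA s' ⟨?_, ?_, ?_, ?_, ?_, ?_, ?_, ?_, ?_, ?_⟩) fun s hs => ?_
    · rw [hs'.arr, hs.input]
    · rw [hs'.reg 1 (by simp), hs.n_eq]
    · rw [hs'.reg 2 (by simp), hs.k_eq]
    · rw [hs'.arr]
      exact hs.deg
    · exact fun w hw h => h.elim
    · simp [hs'.arr, hs.mark]
    · rw [h9, hs.k_eq, hs.numHigh, hs.maxDeg, budget]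
    · rw [hs'.reg 10 (by simp), hs.mid]
    · rw [hs'.reg 12 (by simp), hs.count]
    · rw [hs'.out, hs.out]
    · rw [output, if_pos hred]
      exact runs_emitProg hA s ⟨hs.input, hs.n_eq, hs.k_eq, hs.mark, hs.unmark, hs.out⟩ hs.count
  · refine (Runs.ite_neg (not_not.1 fun h => hred (htest.1 h)) (T := 16)
      (runs_straight_le rfl (by decide) ?_)).mono (by simp only [Expr.cost]; omega) fun _ h => h
    rw [output, if_neg hred]
    have h11 : (2 : ℕ) ≠ 11 := by omega
    simp only [decideProg, Prog.run, Expr.eval, hs.n_eq, hs.k_eq, hs.out, List.nil_append,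
      Function.update_self, Function.update_of_ne h11]
    congr 1
    split_ifs with h <;> omega

end BKernel

/-! ### The kernel of an instance -/

namespace BKernel

open Classical Finset

/-- The adjacency matrix of an instance, extended by zero. -/
noncomputable def adjNat (I : BInstance) (u v : ℕ) : ℕ :=
  if ∃ (hu : u < I.n) (hv : v < I.n), I.G.Adj ⟨u, hu⟩ ⟨v, hv⟩ then 1 else 0

theorem adjNat_val (I : BInstance) (u v : Fin I.n) :
    adjNat I u v = if I.G.Adj u v then 1 else 0 := by
  simp [adjNat]

theorem adjNat_le_one (I : BInstance) (u v : ℕ) : adjNat I u v ≤ 1 := by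
  unfold adjNat
  split_ifs <;> omega

theorem degree_eq_vdeg (I : BInstance) (u : Fin I.n) :
    I.G.degree u = vdeg I.n (adjNat I) u := by
  rw [vdeg, ← Fin.sum_univ_eq_sum_range (adjNat I u) I.n]
  simp_rw [adjNat_val]
  rw [← card_filter, ← SimpleGraph.card_neighborFinset_eq_degree]
  congr 1
  ext v
  simp

theorem card_filter_fin_val (p : ℕ → Prop) (n : ℕ) :
    (univ.filter fun u : Fin n => p u).card = Nat.count p n := by
  rw [Nat.count_eq_card_filter_range, card_filter, card_filter,
    ← Fin.sum_univ_eq_sum_range (fun u => if p u then 1 else 0) n]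

theorem numHighDeg_eq (I : BInstance) : I.ell = numHighUpTo I.n I.k (adjNat I) I.n := by
  rw [numHighUpTo, BInstance.ell, numHighDeg]
  simp_rw [degree_eq_vdeg]
  convert card_filter_fin_val (fun u => I.k ≤ vdeg I.n (adjNat I) u) I.n

theorem maxDeg_eq (I : BInstance) : I.Δ = maxDegUpTo I.n (adjNat I) I.n := by
  refine le_antisymm (SimpleGraph.maxDegree_le_of_forall_degree_le _ _ fun v => ?_)
    (Finset.sup_le fun u hu => ?_)
  · rw [degree_eq_vdeg]
    exact Finset.le_sup (f := vdeg I.n (adjNat I)) (mem_range.2 v.2)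
  · rw [← degree_eq_vdeg I ⟨u, mem_range.1 hu⟩]
    exact degree_le_maxDeg _

theorem budget_eq (I : BInstance) : budget I.n I.k (adjNat I) =
    2 * (I.k + numHighDeg I.G I.k) * I.k * I.k * maxDeg I.G := by
  rw [budget, ← numHighDeg_eq, ← maxDeg_eq]
  rfl

/-- The selected vertices. -/
noncomputable def selSet (I : BInstance) : Finset (Fin I.n) :=
  univ.filter fun u => IsSel I.n I.k (adjNat I) u

theorem mem_selSet {I : BInstance} {u : Fin I.n} :
    u ∈ selSet I ↔ IsSel I.n I.k (adjNat I) u := by simp [selSet]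

theorem count_and_count_lt (p : ℕ → Prop) (M m : ℕ) :
    Nat.count (fun u => p u ∧ Nat.count p u < M) m = min (Nat.count p m) M := by
  induction m with
  | zero => simp
  | succ m ih =>
    rw [Nat.count_succ, Nat.count_succ, ih]
    by_cases h : p m
    · by_cases h' : Nat.count p m < M <;> simp [h, h'] <;> omega
    · simp [h]

theorem card_selSet_mid (I : BInstance) :
    ((selSet I).filter fun v => I.G.degree v + 1 = I.k).card =
      min (numMidUpTo I.n I.k (adjNat I) I.n) (budget I.n I.k (adjNat I)) := by
  have hsel : ((selSet I).filter fun v => I.G.degree v + 1 = I.k) = univ.filter fun u : Fin I.n =>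
      vdeg I.n (adjNat I) u + 1 = I.k ∧
        Nat.count (fun u => vdeg I.n (adjNat I) u + 1 = I.k) u < budget I.n I.k (adjNat I) := by
    ext u
    simp only [mem_filter, mem_selSet, IsSel, numMidUpTo, mem_univ, true_and, degree_eq_vdeg]
    constructor
    · rintro ⟨h | h, h'⟩
      · omega
      · convert h
    · intro h
      refine ⟨Or.inr ?_, h.1⟩
      convert h
  rw [hsel, numMidUpTo]
  refine Eq.trans (b := Nat.count (fun u => vdeg I.n (adjNat I) u + 1 = I.k ∧
    Nat.count (fun u => vdeg I.n (adjNat I) u + 1 = I.k) u < budget I.n I.k (adjNat I)) I.n) ?_ ?_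
  · convert card_filter_fin_val (fun u => vdeg I.n (adjNat I) u + 1 = I.k ∧
      Nat.count (fun u => vdeg I.n (adjNat I) u + 1 = I.k) u < budget I.n I.k (adjNat I)) I.n
  · convert count_and_count_lt (fun u => vdeg I.n (adjNat I) u + 1 = I.k)
      (budget I.n I.k (adjNat I)) I.n

theorem selSet_mid_full_or_many (I : BInstance) :
    (∀ v, I.G.degree v + 1 = I.k → v ∈ selSet I) ∨
      budget I.n I.k (adjNat I) ≤ ((selSet I).filter fun v => I.G.degree v + 1 = I.k).card := by
  rw [card_selSet_mid, le_min_iff]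
  by_cases h : budget I.n I.k (adjNat I) ≤ numMidUpTo I.n I.k (adjNat I) I.n
  · exact Or.inr ⟨h, le_rfl⟩
  · refine Or.inl fun v hv => mem_selSet.2 (Or.inr ?_)
    rw [degree_eq_vdeg] at hv
    exact ⟨hv, (Nat.count_monotone _ v.2.le).trans_lt (not_le.1 h)⟩

theorem le_degree_of_mem_selSet {I : BInstance} {v : Fin I.n} (hv : v ∈ selSet I) :
    I.k ≤ I.G.degree v + 1 := by
  rw [degree_eq_vdeg]
  rcases mem_selSet.1 hv with h | h <;> omega

theorem inKernel_iff (I : BInstance) (w : Fin I.n) : InKernel I.n I.k (adjNat I) w ↔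
    ∃ x ∈ selSet I, w ∈ closedNbhd I.G x := by
  simp only [InKernel, mem_selSet, mem_closedNbhd]
  constructor
  · rintro ⟨u, hu, hs, h⟩
    refine ⟨⟨u, hu⟩, hs, h.imp (fun h => Fin.ext h) fun h => ?_⟩
    by_contra h'
    exact h (by rw [adjNat_val I ⟨u, hu⟩ w, if_neg h'])
  · rintro ⟨u, hs, h⟩
    exact ⟨u, u.2, hs, h.imp (fun h => by rw [h]) fun h => by rw [adjNat_val, if_pos h]; simp⟩

/-- The vertices of the kernel, in increasing order. -/
noncomputable def vertexList (I : BInstance) : List (Fin I.n) :=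
  (List.finRange I.n).filter (InKernel I.n I.k (adjNat I) ·)

theorem vertexList_nodup (I : BInstance) : (vertexList I).Nodup :=
  (List.nodup_finRange _).filter _

theorem mem_vertexList {I : BInstance} {w : Fin I.n} :
    w ∈ vertexList I ↔ ∃ x ∈ selSet I, w ∈ closedNbhd I.G x := by
  simp [vertexList, inKernel_iff]

/-- The kernel of an instance. -/
noncomputable def kernelInstance (I : BInstance) : BInstance where
  n := (vertexList I).length
  G := I.G.comap (vertexList I).get
  k := I.k

theorem isReducible_iff (I : BInstance) : IsReducible I.n I.k (adjNat I) ↔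
    1 ≤ I.k ∧ 1 ≤ maxDeg I.G ∧ I.k ≤ maxDeg I.G + 1 := by
  rw [IsReducible, ← maxDeg_eq]
  rfl

theorem kernelInstance_equiv (I : BInstance) (h : IsReducible I.n I.k (adjNat I)) :
    HasBColoring I.G I.k ↔ HasBColoring (kernelInstance I).G (kernelInstance I).k := by
  rw [isReducible_iff] at h
  refine hasBColoring_comap_iff
    ⟨(vertexList I).get, List.nodup_iff_injective_get.1 (vertexList_nodup I)⟩ h.1 h.2.2 h.2.1
    (selSet I) (fun v => ?_) (fun v hv => ?_) ?_
  · rw [← mem_vertexList, List.mem_iff_get]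
    rfl
  · rw [degree_eq_vdeg] at hv
    exact mem_selSet.2 (Or.inl hv)
  · rw [← budget_eq]
    convert selSet_mid_full_or_many I

theorem kernelInstance_n_le (I : BInstance) : (kernelInstance I).n ≤
    I.ell * (I.Δ + 1) + 2 * (I.k + I.ell) * I.k * I.k * I.Δ * I.k := by
  have h := card_kernel_le (selSet I) (fun v hv => le_degree_of_mem_selSet hv)
    (M := budget I.n I.k (adjNat I)) (by
      convert (card_selSet_mid I).trans_le (min_le_right _ _))
  have hlen : (kernelInstance I).n = ((selSet I).biUnion (closedNbhd I.G)).card := by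
    rw [← show (vertexList I).toFinset = (selSet I).biUnion (closedNbhd I.G) by
      ext w; simp [mem_vertexList], List.toFinset_card_of_nodup (vertexList_nodup I)]
    rfl
  rw [hlen]
  rw [budget_eq] at h
  convert h <;> rfl

theorem le_Δ_of_lt_ell {I : BInstance} (h : I.k < I.ell) : I.k ≤ I.Δ := by
  have h0 : 0 < (highSet I.G I.k).card := (Nat.zero_le _).trans_lt h
  obtain ⟨v, hv⟩ := card_pos.1 h0
  exact (mem_highSet.1 hv).trans (degree_le_maxDeg v)

theorem kernelInstance_n_le_of_lt (I : BInstance) (hk : 1 ≤ I.k) (h : I.k < I.ell) :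
    (kernelInstance I).n ≤ 6 * (I.ell * I.Δ * (min I.ell I.Δ) ^ (I.ell + 1)) := by
  have hΔ := le_Δ_of_lt_ell h
  have hpow : I.k ^ 3 ≤ (min I.ell I.Δ) ^ (I.ell + 1) :=
    (Nat.pow_le_pow_left (le_min h.le hΔ) 3).trans
      (Nat.pow_le_pow_right (lt_min (by omega) (by omega)) (by omega))
  have hk3 : 1 ≤ I.k ^ 3 := Nat.one_le_pow _ _ hk
  calc (kernelInstance I).n
      ≤ I.ell * (I.Δ + 1) + 2 * (I.k + I.ell) * I.k * I.k * I.Δ * I.k := kernelInstance_n_le I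
    _ = I.ell * (I.Δ + 1) * 1 + 2 * (I.k + I.ell) * I.Δ * I.k ^ 3 := by ring
    _ ≤ I.ell * (I.Δ + I.Δ) * I.k ^ 3 + 2 * (I.ell + I.ell) * I.Δ * I.k ^ 3 := by
        gcongr
        omega
    _ = 6 * (I.ell * I.Δ * I.k ^ 3) := by ring
    _ ≤ _ := by gcongr

theorem kernelInstance_n_le_of_le (I : BInstance) (hk : 1 ≤ I.k) (hΔ : 1 ≤ I.Δ)
    (h : I.ell ≤ I.k) : (kernelInstance I).n ≤ 6 * (I.k ^ 4 * I.Δ) := by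
  have hk3 : 1 ≤ I.k ^ 3 := Nat.one_le_pow _ _ hk
  calc (kernelInstance I).n
      ≤ I.ell * (I.Δ + 1) + 2 * (I.k + I.ell) * I.k * I.k * I.Δ * I.k := kernelInstance_n_le I
    _ = I.ell * (I.Δ + 1) * 1 + 2 * (I.k + I.ell) * I.Δ * I.k ^ 3 := by ring
    _ ≤ I.k * (I.Δ + I.Δ) * I.k ^ 3 + 2 * (I.k + I.k) * I.Δ * I.k ^ 3 := by gcongr
    _ = _ := by ring

/-! ### The kernelization -/

/-- The kernelization. -/
noncomputable def kernelization (I : BInstance) : KernelOutput BInstance :=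
  if IsReducible I.n I.k (adjNat I) then .reduced (kernelInstance I)
  else .decided (decide (I.k = min I.n 1))

theorem hasBColoring_iff_of_not_isReducible (I : BInstance)
    (h : ¬ IsReducible I.n I.k (adjNat I)) : HasBColoring I.G I.k ↔ I.k = min I.n 1 := by
  rw [isReducible_iff] at h
  obtain ⟨n, G, k⟩ := I
  dsimp only at *
  by_cases hlt : maxDeg G + 1 < k
  · refine iff_of_false (not_hasBColoring_of_lt hlt) ?_
    have := min_le_right n 1
    omega
  by_cases h0 : k = 0
  · subst h0
    rw [hasBColoring_zero_iff]
    rcases n with _ | n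
    · exact iff_of_true inferInstance rfl
    · exact iff_of_false (fun h => h.false 0) (by omega)
  · obtain rfl : k = 1 := by omega
    rw [hasBColoring_one_iff (by omega)]
    rcases n with _ | n
    · exact iff_of_false (fun ⟨v⟩ => v.elim0) (by omega)
    · exact iff_of_true ⟨0⟩ (by omega)

theorem map_val_vertexList (I : BInstance) :
    (vertexList I).map Fin.val = kernelList I.n I.k (adjNat I) I.n := by
  rw [kernelList, ← List.map_coe_finRange_eq_range, List.filter_map]
  rfl

theorem encode_kernelInstance (I : BInstance) : (kernelInstance I).encode =
    (kernelList I.n I.k (adjNat I) I.n).length :: I.k ::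
      (kernelList I.n I.k (adjNat I) I.n).flatMap fun u =>
        (kernelList I.n I.k (adjNat I) I.n).map (adjNat I u) := by
  have hget : (List.finRange (vertexList I).length).map (vertexList I).get = vertexList I :=
    List.map_get_finRange _
  rw [← map_val_vertexList, List.length_map]
  refine congrArg₂ _ rfl (congrArg₂ _ rfl ?_)
  conv_rhs => rw [← hget]
  simp only [List.flatMap_map, List.map_map]
  refine congrArg (List.flatMap · _) (funext fun u => List.map_congr_left fun v _ => ?_)
  simp only [Function.comp, adjNat_val]
  rfl

theorem encode_kernelization (I : BInstance) :
    KernelOutput.encode BInstance.encode (kernelization I) = output I.n I.k (adjNat I) := by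
  rw [kernelization, output]
  split_ifs with h h'
  · rw [KernelOutput.encode, encode_kernelInstance]
  · simp [KernelOutput.encode, h']
  · simp [KernelOutput.encode, h']

theorem getD_flatMap {α β : Type*} (g : α → List β) (d : β) {n : ℕ} (hg : ∀ x, (g x).length = n)
    {v : ℕ} (hv : v < n) (L : List α) (u : ℕ) (hu : u < L.length) :
    (L.flatMap g).getD (u * n + v) d = (g L[u]).getD v d := by
  induction L generalizing u with
  | nil => simp at hu
  | cons x L ih =>
    rw [List.flatMap_cons]
    cases u with
    | zero =>
      rw [List.getD_append _ _ _ _ (by rw [hg]; omega)]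
      simp
    | succ u =>
      rw [List.getD_append_right _ _ _ _ (by rw [hg, add_mul]; omega), hg,
        show (u + 1) * n + v - n = u * n + v by rw [add_mul]; omega]
      exact ih u (by simpa using hu)

theorem isInput_encode (I : BInstance) :
    IsInput I.n I.k (adjNat I) fun i => I.encode.getD i 0 := by
  refine ⟨rfl, rfl, fun u hu v hv => ?_⟩
  rw [BInstance.encode, show 2 + u * I.n + v = (u * I.n + v) + 1 + 1 by omega,
    List.getD_cons_succ, List.getD_cons_succ, getD_flatMap _ _ (by simp) hv _ _ (by simpa using hu)]
  have := adjNat_val I ⟨u, hu⟩ ⟨v, hv⟩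
  simp [hv, this]

theorem length_le_bitLength (w : List ℕ) : w.length ≤ bitLength w := by
  induction w with
  | nil => simp [bitLength]
  | cons x w ih =>
    simp only [bitLength, List.map_cons, List.sum_cons, List.length_cons] at *
    omega

theorem length_encode (I : BInstance) : I.encode.length = I.n * I.n + 2 := by
  simp [BInstance.encode, List.length_flatMap]

theorem polyTimeComputable_kernelization : PolyTimeComputable BInstance.encode
    (KernelOutput.encode BInstance.encode) kernelization := by
  refine ⟨kernelProg, Polynomial.C 200 * Polynomial.X * Polynomial.X, fun I => ?_⟩
  obtain ⟨t, s, he, ht, hs⟩ := runs_kernelProg (adjNat_le_one I) (isInput_encode I)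
    (Ram.init I.encode) rfl (fun r hr => by simp [Ram.init, hr])
    (by ext; simp [Ram.init]) rfl
  refine ⟨t, s, he, by rw [hs, encode_kernelization], ht.trans ?_⟩
  have hn : I.n + 1 ≤ bitLength I.encode := by
    refine le_trans ?_ (length_le_bitLength _)
    rw [length_encode]
    nlinarith [Nat.le_mul_self I.n]
  simp only [Polynomial.eval_mul, Polynomial.eval_C, Polynomial.eval_X]
  gcongr

theorem size_le_self (x : ℕ) : Nat.size x ≤ x := Nat.size_le.2 Nat.lt_two_pow_self

theorem bitLength_encode_le (I : BInstance) :
    bitLength I.encode ≤ I.n + I.k + 2 + 2 * (I.n * I.n) := by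
  have hrest : ∀ w : List ℕ, (∀ x ∈ w, x ≤ 1) → bitLength w ≤ 2 * w.length := by
    intro w
    induction w with
    | nil => simp [bitLength]
    | cons x w ih =>
      intro h
      have h1 := ih fun y hy => h y (List.mem_cons_of_mem _ hy)
      have h2 := (size_le_self x).trans (h x List.mem_cons_self)
      simp only [bitLength, List.map_cons, List.sum_cons, List.length_cons] at *
      omega
  have h1 := hrest ((List.finRange I.n).flatMap fun u =>
    (List.finRange I.n).map fun v => if I.G.Adj u v then 1 else 0) (by
      intro x hx
      simp only [List.mem_flatMap, List.mem_map] at hx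
      obtain ⟨u, -, v, -, rfl⟩ := hx
      split_ifs <;> simp)
  have h2 := length_encode I
  have h3 := size_le_self I.n
  have h4 := size_le_self I.k
  simp only [BInstance.encode, bitLength, List.map_cons, List.sum_cons, List.length_cons] at *
  omega

theorem param_le (I : BInstance) : I.Δ + I.ell ≤ 2 * I.n := by
  have h1 : I.Δ ≤ I.n := by
    rw [maxDeg_eq]
    exact maxDegUpTo_le (adjNat_le_one I) _
  have h2 : I.ell ≤ I.n := by
    rw [numHighDeg_eq]
    exact Nat.count_le _
  omega

/-- A bound for the number of vertices of the kernel in terms of the parameter. -/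
def vertexBound (m : ℕ) : ℕ := m * (m + 1) + 2 * (m + 1 + m) * (m + 1) * (m + 1) * m * (m + 1)

/-- A bound for the size of the kernel in terms of the parameter. -/
def sizeBound (m : ℕ) : ℕ :=
  vertexBound m + (m + 1) + 2 + 2 * (vertexBound m * vertexBound m) + 2 * vertexBound m

theorem computable_sizeBound : Computable sizeBound := by
  have hs : Primrec fun m : ℕ => m + 1 := Primrec.succ
  have hid : Primrec fun m : ℕ => m := Primrec.id
  have add {f g : ℕ → ℕ} (hf : Primrec f) (hg : Primrec g) : Primrec fun m => f m + g m :=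
    Primrec.nat_add.comp hf hg
  have mul {f g : ℕ → ℕ} (hf : Primrec f) (hg : Primrec g) : Primrec fun m => f m * g m :=
    Primrec.nat_mul.comp hf hg
  have hv : Primrec vertexBound :=
    add (mul hid hs) (mul (mul (mul (mul (mul (.const 2) (add hs hid)) hs) hs) hid) hs)
  exact (add (add (add (add hv hs) (.const 2)) (mul (.const 2) (mul hv hv)))
    (mul (.const 2) hv)).to_comp

theorem kernelization_eq_reduced {I J : BInstance} (h : kernelization I = .reduced J) :
    IsReducible I.n I.k (adjNat I) ∧ kernelInstance I = J := by
  rw [kernelization] at h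
  split_ifs at h with hred
  exact ⟨hred, KernelOutput.reduced.inj h⟩

theorem isKernelization : IsKernelization bColoringProblem kernelization := by
  refine ⟨polyTimeComputable_kernelization, fun I b h => ?_, fun I J h => ?_, sizeBound,
    computable_sizeBound, fun I J h => ?_⟩
  · rw [kernelization] at h
    split_ifs at h with hred
    rw [← KernelOutput.decided.inj h, decide_eq_true_iff]
    exact (hasBColoring_iff_of_not_isReducible I hred).symm
  · obtain ⟨hred, rfl⟩ := kernelization_eq_reduced h
    exact kernelInstance_equiv I hred
  · obtain ⟨hred, rfl⟩ := kernelization_eq_reduced h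
    have hk : I.k ≤ I.Δ + I.ell + 1 := by
      have : I.k ≤ I.Δ + 1 := ((isReducible_iff I).1 hred).2.2
      omega
    have hn : (kernelInstance I).n ≤ vertexBound (I.Δ + I.ell) := by
      refine (kernelInstance_n_le I).trans ?_
      unfold vertexBound
      gcongr <;> omega
    have hb := bitLength_encode_le (kernelInstance I)
    have hp := param_le (kernelInstance I)
    have hm := Nat.mul_le_mul hn hn
    have hk' : (kernelInstance I).k = I.k := rfl
    change bitLength (kernelInstance I).encode + ((kernelInstance I).Δ + (kernelInstance I).ell) ≤
      sizeBound (I.Δ + I.ell)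
    unfold sizeBound
    omega

end BKernel

theorem mainTheorem11 :
    ∃ K : BInstance → KernelOutput BInstance,
      IsKernelization bColoringProblem K ∧
      ∃ C : ℕ, ∀ I J : BInstance, K I = .reduced J →
        (I.k < I.ell → J.n ≤ C * (I.ell * I.Δ * (min I.ell I.Δ) ^ (I.ell + 1))) ∧
        (I.ell ≤ I.k → J.n ≤ C * (I.k ^ 4 * I.Δ)) := by
  refine ⟨BKernel.kernelization, BKernel.isKernelization, 6, fun I J h => ?_⟩
  obtain ⟨hred, rfl⟩ := BKernel.kernelization_eq_reduced h
  rw [BKernel.isReducible_iff] at hred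
  exact ⟨BKernel.kernelInstance_n_le_of_lt I hred.1,
    BKernel.kernelInstance_n_le_of_le I hred.1 hred.2.1⟩
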